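/- Let $p: Z\to Y$ be a holomorphic submersion of complex manifolds (each of pure finite dimension). Let $\mathcal C^\infty$ denote the sheaf of $\mathbb C$-valued $C^\infty$ functions on the underlying real manifold, $\mathcal D_Z,\mathcal D_Y$ the sheaves of holomorphic differential operators (which act on $\mathcal C^\infty_Z$, $\mathcal C^\infty_Y$), $\Theta_{Z/Y}$ the sheaf of holomorphic vector fields on $Z$ tangent to the fibres of $p$, and $$\mathcal D_{Z\to Y}:=\mathcal D_Z/(\mathcal D_Z\cdot\Theta_{Z/Y})$$ the quotient sheaf, with $1_{Z\to Y}\in\Gamma(Z,\mathcal D_{Z\to Y})$ the class of $1$. The sheaf $\mathcal D_{Z\to Y}$ is a left $\mathcal D_Z$-module. It is also a right $p^{-1}(\mathcal D_Y)$-module: for $U\subset Z$ open, $Q\in\mathcal D_Y(p(U))$ and $s\in\mathcal D_{Z\to Y}(U)$, there is a unique section $s\cdot Q\in\mathcal D_{Z\to Y}(U)$ such that every point of $U$ has an open neighbourhood $V\subset U$ on which $s=[P]$ and $s\cdot Q=[PR]$ for some $P,R\in\mathcal D_Z(V)$, where the class $[R]$ is invariant under the commutator action of $\Theta_{Z/Y}|_V$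 and $R(g\circ p)=(Qg)\circ p$ for all open $V'\subset V$ and all holomorphic functions $g$ on $p(V')$. Let $\mathcal Hom(p^{-1}\mathcal C^\infty_Y,\mathcal C^\infty_Z)$ be the sheaf of $\mathbb C$-linear homomorphisms; its sections over $U$ are the families of linear maps $\phi_V: C^\infty(p(V))\to C^\infty(V)$, $V\subset U$ open, compatible with restrictions. It is a $(\mathcal D_Z,p^{-1}(\mathcal D_Y))$-bimodule via $\phi\mapsto P\circ\phi\circ Q$. Let $\mathbf p^{*}_{C^\infty}$ be its global section given by the pull-back $f\mapsto f\circ p$ of smooth functions. (1) There is a unique homomorphism of $(\mathcal D_Z,p^{-1}(\mathcal D_Y))$-bimodules $$\mathcal D_{Z\to Y}\to\mathcal Hom(p^{-1}\mathcal C^\infty_Y,\mathcal C^\infty_Z)$$ sending $1_{Z\to Y}$ to $\mathbf p^{*}_{C^\infty}$, and it is injective. (2) If $P\in\Gamma(Z,\mathcal D_Z)$ satisfies $P\cdot 1_{Z\to Y}=0$, then $P\cdot\mathbf p^{*}_{C^\infty}=0$ and $\overline P\cdot\mathbf p^{*}_{C^\infty}=0$, where $\overline P f:=\overline{P(\overline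 f)}$. -/

import Mathlib

open TopologicalSpace Manifold
open scoped ContDiff ComplexConjugate

noncomputable section

namespace HolD

section Functions

variable (E : Type*) [NormedAddCommGroup E] [NormedSpace ℂ E]
  {Z : Type*} [TopologicalSpace Z] [ChartedSpace E Z]

/-- The algebra `C^∞(U)` of complex valued functions on the open set `U` that are smooth for the
underlying real manifold structure. -/
def smoothSubalgebra (U : Opens Z) : Subalgebra ℂ (U → ℂ) where
  carrier := {f | ContMDiff 𝓘(ℝ, E) 𝓘(ℝ, ℂ) ∞ f}
  mul_mem' hf hg := by
    intro x
    exact ((contDiff_mul (𝕜 := ℝ) (𝔸 := ℂ) (n := ∞)).contMDiff).contMDiffAt.comp x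
      ((hf x).prodMk_space (hg x))
  add_mem' hf hg := by
    intro x
    exact ((contDiff_add (𝕜 := ℝ) (F := ℂ) (n := ∞)).contMDiff).contMDiffAt.comp x
      ((hf x).prodMk_space (hg x))
  algebraMap_mem' c := contMDiff_const

/-- The algebra `C^∞(U)` as a type. -/
def Smooth (U : Opens Z) : Type _ := smoothSubalgebra E U

instance (U : Opens Z) : CommRing (Smooth E U) := inferInstanceAs (CommRing (smoothSubalgebra E U))

instance (U : Opens Z) : Algebra ℂ (Smooth E U) :=
  inferInstanceAs (Algebra ℂ (smoothSubalgebra E U))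

variable {E}

@[ext]
theorem Smooth.ext {U : Opens Z} {f g : Smooth E U} (h : ∀ z, f.1 z = g.1 z) : f = g :=
  Subtype.ext (funext h)

/-- Restriction of smooth functions. -/
def Smooth.res {U V : Opens Z} (h : V ≤ U) : Smooth E U →ₐ[ℂ] Smooth E V where
  toFun f := ⟨f.1 ∘ Set.inclusion h,
    ContMDiff.comp (I' := 𝓘(ℝ, E)) f.2 (contMDiff_inclusion h)⟩
  map_one' := rfl
  map_mul' _ _ := rfl
  map_zero' := rfl
  map_add' _ _ := rfl
  commutes' _ := rfl

/-- The complex conjugate of a smooth function. -/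
def Smooth.conj {U : Opens Z} (f : Smooth E U) : Smooth E U :=
  ⟨fun z => (starRingEnd ℂ) (f.1 z),
    ContMDiff.comp (I' := 𝓘(ℝ, ℂ)) (Complex.conjCLE.contDiff.contMDiff) f.2⟩

/-- Holomorphic functions, as a subset of the smooth ones: `O(U) ⊆ C^∞(U)`. -/
def Smooth.IsHol {U : Opens Z} (f : Smooth E U) : Prop :=
  ContMDiff 𝓘(ℂ, E) 𝓘(ℂ, ℂ) ω f.1

variable (E)

/-- The algebra of `ℂ`-linear endomorphisms of the sheaf `C^∞` restricted to `U`: families of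
linear endomorphisms of `C^∞(V)`, for `V ⊆ U` open, that commute with restrictions. -/
def smoothEndSubalgebra (U : Opens Z) :
    Subalgebra ℂ (∀ V : Set.Iic U, Module.End ℂ (Smooth E V.1)) where
  carrier := {P | ∀ (V W : Set.Iic U) (h : W.1 ≤ V.1) (f : Smooth E V.1),
    Smooth.res h (P V f) = P W (Smooth.res h f)}
  mul_mem' {P Q} hP hQ V W h f := by
    change Smooth.res h (P V (Q V f)) = P W (Q W (Smooth.res h f))
    rw [hP, hQ]
  add_mem' {P Q} hP hQ V W h f := by
    change Smooth.res h (P V f + Q V f) = P W (Smooth.res h f) + Q W (Smooth.res h f)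
    rw [map_add, hP, hQ]
  algebraMap_mem' c V W h f := map_smul (Smooth.res h) c f

/-- The algebra of endomorphisms of the sheaf `C^∞` restricted to `U`, as a type. -/
def SmoothEnd (U : Opens Z) : Type _ := smoothEndSubalgebra E U

instance (U : Opens Z) : Ring (SmoothEnd E U) :=
  inferInstanceAs (Ring (smoothEndSubalgebra E U))

instance (U : Opens Z) : Algebra ℂ (SmoothEnd E U) :=
  inferInstanceAs (Algebra ℂ (smoothEndSubalgebra E U))

variable {E}

/-- The operator on `C^∞(V)` given by a sheaf endomorphism over `U ⊇ V`. -/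
def SmoothEnd.app {U : Opens Z} (P : SmoothEnd E U) (V : Opens Z) (h : V ≤ U) :
    Smooth E V →ₗ[ℂ] Smooth E V := P.1 ⟨V, h⟩

/-- Restriction of sheaf endomorphisms. -/
def SmoothEnd.res {U V : Opens Z} (h : V ≤ U) : SmoothEnd E U →ₐ[ℂ] SmoothEnd E V where
  toFun P := ⟨fun W => P.1 ⟨W.1, le_trans W.2 h⟩, fun V W h' f =>
    P.2 ⟨V.1, le_trans V.2 h⟩ ⟨W.1, le_trans W.2 h⟩ h' f⟩
  map_one' := rfl
  map_mul' _ _ := rfl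
  map_zero' := rfl
  map_add' _ _ := rfl
  commutes' _ := rfl

/-- Multiplication by a smooth function. -/
def mulOp {U : Opens Z} (a : Smooth E U) : SmoothEnd E U :=
  ⟨fun V => LinearMap.mulLeft ℂ (Smooth.res V.2 a), fun _ _ _ _ => rfl⟩

/-- The complex conjugate operator `f ↦ conj (P (conj f))`. -/
def SmoothEnd.conj {U : Opens Z} (P : SmoothEnd E U) : SmoothEnd E U :=
  ⟨fun V =>
    { toFun := fun f => (P.1 V f.conj).conj
      map_add' := fun f g => by
        have : (f + g).conj = f.conj + g.conj := by ext z; exact map_add (starRingEnd ℂ) _ _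
        rw [this, map_add]; ext z; exact map_add (starRingEnd ℂ) _ _
      map_smul' := fun c f => by
        have : (c • f).conj = (starRingEnd ℂ c) • f.conj := by
          ext z; exact map_mul (starRingEnd ℂ) _ _
        rw [this, map_smul]; ext z
        refine (map_mul (starRingEnd ℂ) _ _).trans ?_
        rw [Complex.conj_conj]; rfl },
   fun V W h f => congrArg Smooth.conj (P.2 V W h f.conj)⟩

/-- Holomorphic vector fields on `U`, as operators on smooth functions. The first condition says
that `ξ` is a complex vector field, `(ξ f)(z) = df_z(v_z)`: the value of `ξ f` at `z` depends only
on the differential of `f` at `z`, and hence depends linearly on it. The other two say that `ξ`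
is of type `(1,0)` and holomorphic: it preserves holomorphic functions and annihilates
antiholomorphic ones. In local coordinates `ξ = ∑ aᵢ ∂/∂zᵢ` with `aᵢ` holomorphic. -/
structure IsHolVectorField {U : Opens Z} (ξ : SmoothEnd E U) : Prop where
  map_eq_zero : ∀ (V : Opens Z) (h : V ≤ U) (f : Smooth E V) (z : V),
    mfderiv 𝓘(ℝ, E) 𝓘(ℝ, ℂ) f.1 z = 0 → (ξ.app V h f).1 z = 0
  map_hol : ∀ (V : Opens Z) (h : V ≤ U) (f : Smooth E V), f.IsHol → (ξ.app V h f).IsHol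
  map_conj_hol : ∀ (V : Opens Z) (h : V ≤ U) (f : Smooth E V), f.IsHol → ξ.app V h f.conj = 0

theorem IsHolVectorField.res {U V : Opens Z} (h : V ≤ U) {ξ : SmoothEnd E U}
    (hξ : IsHolVectorField ξ) : IsHolVectorField (SmoothEnd.res h ξ) :=
  ⟨fun W hW => hξ.map_eq_zero W (hW.trans h), fun W hW => hξ.map_hol W (hW.trans h),
    fun W hW => hξ.map_conj_hol W (hW.trans h)⟩

theorem Smooth.IsHol.res {U V : Opens Z} (h : V ≤ U) {f : Smooth E U} (hf : f.IsHol) :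
    (Smooth.res h f).IsHol :=
  ContMDiff.comp (I' := 𝓘(ℂ, E)) (g := f.1) hf (contMDiff_inclusion h)

variable (E)

/-- The algebra generated over `ℂ` by the holomorphic functions on `U` and the holomorphic vector
fields on `U`. -/
def generatedOps (U : Opens Z) : Subalgebra ℂ (SmoothEnd E U) :=
  Algebra.adjoin ℂ ({P | ∃ a : Smooth E U, a.IsHol ∧ P = mulOp a} ∪ {ξ | IsHolVectorField ξ})

variable {E}

theorem generatedOps_res {U V : Opens Z} (h : V ≤ U) {P : SmoothEnd E U}
    (hP : P ∈ generatedOps E U) : SmoothEnd.res h P ∈ generatedOps E V := by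
  have : generatedOps E U ≤ (generatedOps E V).comap (SmoothEnd.res h) := by
    refine Algebra.adjoin_le ?_
    rintro _ (⟨a, ha, rfl⟩ | hξ)
    · exact Algebra.subset_adjoin (Or.inl ⟨Smooth.res h a, ha.res h, rfl⟩)
    · exact Algebra.subset_adjoin (Or.inr (IsHolVectorField.res h hξ))
  exact this hP

variable (E)

/-- The sections over `U` of the sheaf `D` of holomorphic differential operators: the operators on
smooth functions that are, locally on `U`, polynomial expressions in holomorphic functions and
holomorphic vector fields (in local coordinates: `∑ a_α ∂^α/∂z^α` with `a_α` holomorphic). -/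
def diffOpSubalgebra (U : Opens Z) : Subalgebra ℂ (SmoothEnd E U) where
  carrier := {P | ∀ z ∈ U, ∃ (V : Opens Z) (h : V ≤ U), z ∈ V ∧
    SmoothEnd.res h P ∈ generatedOps E V}
  mul_mem' {P Q} hP hQ z hz := by
    obtain ⟨V, h, hV, hPV⟩ := hP z hz
    obtain ⟨W, h', hW, hQW⟩ := hQ z hz
    refine ⟨V ⊓ W, inf_le_left.trans h, ⟨hV, hW⟩, ?_⟩
    rw [map_mul]
    exact mul_mem (generatedOps_res (inf_le_left : V ⊓ W ≤ V) hPV)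
      (generatedOps_res (inf_le_right : V ⊓ W ≤ W) hQW)
  add_mem' {P Q} hP hQ z hz := by
    obtain ⟨V, h, hV, hPV⟩ := hP z hz
    obtain ⟨W, h', hW, hQW⟩ := hQ z hz
    refine ⟨V ⊓ W, inf_le_left.trans h, ⟨hV, hW⟩, ?_⟩
    rw [map_add]
    exact add_mem (generatedOps_res (inf_le_left : V ⊓ W ≤ V) hPV)
      (generatedOps_res (inf_le_right : V ⊓ W ≤ W) hQW)
  algebraMap_mem' c z hz := ⟨U, le_rfl, hz, (generatedOps E U).algebraMap_mem c⟩

/-- The algebra `D(U)` of holomorphic differential operators on `U`, as a type. -/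
def DiffOp (U : Opens Z) : Type _ := diffOpSubalgebra E U

instance (U : Opens Z) : Ring (DiffOp E U) := inferInstanceAs (Ring (diffOpSubalgebra E U))

instance (U : Opens Z) : Algebra ℂ (DiffOp E U) :=
  inferInstanceAs (Algebra ℂ (diffOpSubalgebra E U))

variable {E}

/-- A holomorphic differential operator as an endomorphism of the sheaf of smooth functions. -/
def DiffOp.toEnd (U : Opens Z) : DiffOp E U →ₐ[ℂ] SmoothEnd E U := (diffOpSubalgebra E U).val

/-- Restriction of holomorphic differential operators. -/
def DiffOp.res {U V : Opens Z} (h : V ≤ U) : DiffOp E U →ₐ[ℂ] DiffOp E V :=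
  ((SmoothEnd.res h).comp (DiffOp.toEnd U)).codRestrict (diffOpSubalgebra E V) (by
    rintro ⟨P, hP⟩ z hz
    obtain ⟨W, hW, hzW, hPW⟩ := hP z (h hz)
    exact ⟨W ⊓ V, inf_le_right, ⟨hzW, hz⟩, generatedOps_res (inf_le_left : W ⊓ V ≤ W) hPW⟩)

/-- The operator on `C^∞(V)` given by a differential operator on `U ⊇ V`. -/
def DiffOp.app {U : Opens Z} (P : DiffOp E U) (V : Opens Z) (h : V ≤ U) :
    Smooth E V →ₗ[ℂ] Smooth E V := P.1.app V h

end Functions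

section Stalks

variable (E : Type*) [NormedAddCommGroup E] [NormedSpace ℂ E]
  {Z : Type*} [TopologicalSpace Z] [ChartedSpace E Z]

/-- Open neighbourhoods of `z`, ordered by reverse inclusion. -/
abbrev Nhd (z : Z) : Type _ := {V : Opens Z // z ∈ V}ᵒᵈ

instance (z : Z) : IsDirectedOrder (Nhd z) :=
  ⟨fun V W => ⟨OrderDual.toDual ⟨(OrderDual.ofDual V).1 ⊓ (OrderDual.ofDual W).1,
    ⟨(OrderDual.ofDual V).2, (OrderDual.ofDual W).2⟩⟩,
    (inf_le_left : (OrderDual.ofDual V).1 ⊓ (OrderDual.ofDual W).1 ≤ _),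
    (inf_le_right : (OrderDual.ofDual V).1 ⊓ (OrderDual.ofDual W).1 ≤ _)⟩⟩

instance (z : Z) : Nonempty (Nhd z) := ⟨OrderDual.toDual ⟨⊤, trivial⟩⟩

/-- The restriction maps of `D` along the neighbourhoods of `z`. -/
def nhdRes {z : Z} (V W : Nhd z) (h : V ≤ W) :
    DiffOp E (OrderDual.ofDual V).1 →+* DiffOp E (OrderDual.ofDual W).1 :=
  (DiffOp.res (E := E) (U := (OrderDual.ofDual V).1) (V := (OrderDual.ofDual W).1) h).toRingHom

instance (z : Z) : DirectedSystem (fun V : Nhd z => DiffOp E (OrderDual.ofDual V).1)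
    (fun V W h => nhdRes E V W h) where
  map_self _ _ := rfl
  map_map _ _ _ _ _ _ := rfl

/-- The stalk `D_z` of the sheaf of holomorphic differential operators. -/
def DStalk (z : Z) : Type _ :=
  DirectLimit (fun V : Nhd z => DiffOp E (OrderDual.ofDual V).1) (nhdRes E)

instance (z : Z) : Ring (DStalk E z) := inferInstanceAs (Ring
  (DirectLimit (fun V : Nhd z => DiffOp E (OrderDual.ofDual V).1) (nhdRes E)))

variable {E}

/-- The germ at `z ∈ U` of a differential operator on `U`. -/
def germ {U : Opens Z} {z : Z} (hz : z ∈ U) : DiffOp E U →+* DStalk E z where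
  toFun P := (⟦⟨OrderDual.toDual ⟨U, hz⟩, P⟩⟧ :
    DirectLimit (fun V : Nhd z => DiffOp E (OrderDual.ofDual V).1) (nhdRes E))
  map_one' := (DirectLimit.one_def (f := nhdRes E) (OrderDual.toDual ⟨U, hz⟩)).symm
  map_mul' P Q := (DirectLimit.mul_def (f := nhdRes E) (OrderDual.toDual ⟨U, hz⟩) P Q).symm
  map_zero' := (DirectLimit.zero_def (f := nhdRes E) (OrderDual.toDual ⟨U, hz⟩)).symm
  map_add' P Q := (DirectLimit.add_def (f := nhdRes E) (OrderDual.toDual ⟨U, hz⟩) P Q).symm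

theorem germ_res {U V : Opens Z} (h : V ≤ U) {z : Z} (hz : z ∈ V) (P : DiffOp E U) :
    germ hz (DiffOp.res h P) = germ (h hz) P :=
  (DirectLimit.eq_of_le (f := nhdRes E)
    (⟨OrderDual.toDual ⟨U, h hz⟩, P⟩ : Σ V : Nhd z, DiffOp E (OrderDual.ofDual V).1)
    (OrderDual.toDual ⟨V, hz⟩) h).symm

end Stalks

section Submersion

variable {E : Type*} [NormedAddCommGroup E] [NormedSpace ℂ E]
  {F : Type*} [NormedAddCommGroup F] [NormedSpace ℂ F]
  {Z : Type*} [TopologicalSpace Z] [ChartedSpace E Z]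
  {Y : Type*} [TopologicalSpace Y] [ChartedSpace F Y]
  {p : Z → Y}

theorem isOpenMap_of_isSubmersion (hp : IsSubmersion 𝓘(ℂ, E) 𝓘(ℂ, F) ω p) : IsOpenMap p := by
  rw [isOpenMap_iff_nhds_le]
  intro x
  have h := hp.isSubmersionOfComplement_complement x
  have hx := h.mem_domChart_source
  have h1 : Filter.map (h.codChart ∘ p) (nhds x) = nhds (h.codChart (p x)) := by
    have e : h.codChart ∘ p =ᶠ[nhds x] (Prod.fst ∘ h.equiv) ∘ h.domChart := by
      filter_upwards [h.domChart.open_source.mem_nhds hx] with y hy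
      have hy' : h.domChart y ∈ (h.domChart.extend 𝓘(ℂ, E)).target := by
        simpa using h.domChart.map_source hy
      simpa [h.domChart.left_inv hy] using h.writtenInCharts hy'
    have e0 : h.codChart (p x) = _ := e.self_of_nhds
    rw [Filter.map_congr e, e0, ← Filter.map_map, h.domChart.map_nhds_eq hx]
    exact (isOpenMap_fst.comp h.equiv.toHomeomorph.isOpenMap).map_nhds_eq
      (continuous_fst.comp h.equiv.continuous).continuousAt
  have hy := h.mem_codChart_source
  rw [← h.codChart.symm_map_nhds_eq hy, ← h1, Filter.map_map]
  refine (Filter.map_congr ?_).le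
  filter_upwards [h.domChart.open_source.mem_nhds hx] with z hz
  exact h.codChart.left_inv (h.source_subset_preimage_source hz)

theorem contMDiff_real_of_isSubmersion (hp : IsSubmersion 𝓘(ℂ, E) 𝓘(ℂ, F) ω p) :
    ContMDiff 𝓘(ℝ, E) 𝓘(ℝ, F) ∞ p := by
  intro x
  obtain ⟨hc, hd⟩ := contMDiffAt_iff.1 (hp.contMDiff x)
  exact contMDiffAt_iff.2 ⟨hc, (hd.restrict_scalars ℝ).of_le le_top⟩

variable (hp : IsSubmersion 𝓘(ℂ, E) 𝓘(ℂ, F) ω p)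

/-- The open image `p(U)` of an open set `U`. -/
def img (U : Opens Z) : Opens Y := ⟨p '' U, isOpenMap_of_isSubmersion hp U U.2⟩

theorem img_mono {U V : Opens Z} (h : V ≤ U) : img hp V ≤ img hp U := Set.image_mono h

/-- Pull-back of smooth functions `C^∞(p(U)) → C^∞(U)`, `f ↦ f ∘ p`. -/
def pullback (U : Opens Z) : Smooth F (img hp U) →ₐ[ℂ] Smooth E U where
  toFun f := ⟨fun z => f.1 ⟨p z.1, Set.mem_image_of_mem p z.2⟩, by
    classical
    let g : Y → ℂ := fun y => if h : y ∈ img hp U then f.1 ⟨y, h⟩ else 0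
    have hg : ∀ y : img hp U, g y.1 = f.1 y := fun y => dif_pos y.2
    intro z
    have h1 : ContMDiffAt 𝓘(ℝ, F) 𝓘(ℝ, ℂ) ∞ g (p z.1) := by
      refine (contMDiffAt_subtype_iff (U := img hp U)
        (x := ⟨p z.1, Set.mem_image_of_mem p z.2⟩)).1 ?_
      exact (f.2 _).congr_of_eventuallyEq (Filter.Eventually.of_forall hg)
    have h2 : ContMDiffAt 𝓘(ℝ, E) 𝓘(ℝ, ℂ) ∞ (g ∘ p) z.1 :=
      h1.comp z.1 (contMDiff_real_of_isSubmersion hp z.1)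
    refine (contMDiffAt_subtype_iff.2 h2).congr_of_eventuallyEq (Filter.Eventually.of_forall ?_)
    exact fun w => (hg ⟨p w.1, Set.mem_image_of_mem p w.2⟩).symm⟩
  map_one' := rfl
  map_mul' _ _ := rfl
  map_zero' := rfl
  map_add' _ _ := rfl
  commutes' _ := rfl

/-- The sections over `U` of the relative tangent sheaf `Θ_{Z/Y}`: holomorphic vector fields that
are tangent to the fibres of `p`, that is, annihilate the functions `g ∘ p` with `g` holomorphic. -/
structure IsVertical {U : Opens Z} (ξ : DiffOp E U) : Prop where
  isHolVectorField : IsHolVectorField (DiffOp.toEnd U ξ)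
  map_pullback : ∀ (V : Opens Z) (h : V ≤ U) (g : Smooth F (img hp V)), g.IsHol →
    ξ.app V h (pullback hp V g) = 0

/-- The left ideal `D_z · Θ_{Z/Y,z}` of the stalk `D_z`. -/
def verticalIdeal (z : Z) : Submodule (DStalk E z) (DStalk E z) :=
  Submodule.span (DStalk E z)
    {x | ∃ (U : Opens Z) (hz : z ∈ U) (ξ : DiffOp E U), IsVertical hp ξ ∧ x = germ hz ξ}

/-- The stalk at `z` of the quotient sheaf `D_Z / D_Z · Θ_{Z/Y}`. -/
def TransferStalk (z : Z) : Type _ := DStalk E z ⧸ verticalIdeal hp z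

instance (z : Z) : AddCommGroup (TransferStalk hp z) :=
  inferInstanceAs (AddCommGroup (DStalk E z ⧸ verticalIdeal hp z))

instance (z : Z) : Module (DStalk E z) (TransferStalk hp z) :=
  inferInstanceAs (Module (DStalk E z) (DStalk E z ⧸ verticalIdeal hp z))

/-- Differential operators on `U` act on the stalk at `z ∈ U` through their germs. -/
instance (U : Opens Z) (z : U) : Module (DiffOp E U) (TransferStalk hp z.1) :=
  Module.compHom (TransferStalk hp z.1) (germ (E := E) z.2)

/-- The class in the stalk at `z ∈ U` of a differential operator on `U`. -/
def cls {U : Opens Z} (P : DiffOp E U) (z : Z) (hz : z ∈ U) : TransferStalk hp z :=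
  Submodule.Quotient.mk (germ hz P)

theorem cls_res {U V : Opens Z} (h : V ≤ U) (P : DiffOp E U) (z : Z) (hz : z ∈ V) :
    cls hp (DiffOp.res h P) z hz = cls hp P z (h hz) :=
  congrArg _ (germ_res h hz P)

theorem cls_add {U : Opens Z} (P Q : DiffOp E U) (z : Z) (hz : z ∈ U) :
    cls hp (P + Q) z hz = cls hp P z hz + cls hp Q z hz := by
  rw [cls, map_add]; rfl

theorem cls_mul {U : Opens Z} (P Q : DiffOp E U) (z : Z) (hz : z ∈ U) :
    cls hp (P * Q) z hz = germ hz P • cls hp Q z hz := by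
  rw [cls, map_mul]; rfl

/-- The sections over `U` of the quotient sheaf `D_{Z→Y} = D_Z / D_Z · Θ_{Z/Y}` (the sheaf
associated to the presheaf quotient): families of elements of the stalks that are locally the
classes of differential operators. It is a left module over `D_Z(U)`. -/
def transferSections (U : Opens Z) : Submodule (DiffOp E U) (∀ z : U, TransferStalk hp z.1) where
  carrier := {s | ∀ z ∈ U, ∃ (V : Opens Z) (h : V ≤ U) (P : DiffOp E V), z ∈ V ∧
    ∀ (w : Z) (hw : w ∈ V), s ⟨w, h hw⟩ = cls hp P w hw}
  add_mem' {s t} hs ht z hz := by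
    obtain ⟨V, h, P, hV, hP⟩ := hs z hz
    obtain ⟨W, h', Q, hW, hQ⟩ := ht z hz
    refine ⟨V ⊓ W, inf_le_left.trans h, DiffOp.res inf_le_left P + DiffOp.res inf_le_right Q,
      ⟨hV, hW⟩, fun w hw => ?_⟩
    rw [cls_add, cls_res, cls_res, ← hP, ← hQ]; rfl
  zero_mem' z hz := ⟨U, le_rfl, 0, hz, fun w hw => by rw [cls, map_zero]; rfl⟩
  smul_mem' R s hs z hz := by
    obtain ⟨V, h, P, hV, hP⟩ := hs z hz
    refine ⟨V, h, DiffOp.res h R * P, hV, fun w hw => ?_⟩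
    rw [cls_mul, germ_res, ← hP]; rfl

/-- The left `D_Z(U)`-module `D_{Z→Y}(U)`, as a type. -/
def Transfer (U : Opens Z) : Type _ := transferSections hp U

instance (U : Opens Z) : AddCommGroup (Transfer hp U) :=
  inferInstanceAs (AddCommGroup (transferSections hp U))

instance (U : Opens Z) : Module (DiffOp E U) (Transfer hp U) :=
  inferInstanceAs (Module (DiffOp E U) (transferSections hp U))

/-- Restriction of sections of `D_{Z→Y}`. -/
def Transfer.res {U V : Opens Z} (h : V ≤ U) (s : Transfer hp U) : Transfer hp V :=
  ⟨fun z => s.1 ⟨z.1, h z.2⟩, fun z hz => by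
    obtain ⟨W, hW, P, hzW, hP⟩ := s.2 z (h hz)
    refine ⟨W ⊓ V, inf_le_right, DiffOp.res inf_le_left P, ⟨hzW, hz⟩, fun w hw => ?_⟩
    rw [cls_res]; exact hP w hw.1⟩

/-- The section of `D_{Z→Y}` over `U` defined by a differential operator. -/
def Transfer.mk {U : Opens Z} (P : DiffOp E U) : Transfer hp U :=
  ⟨fun z => cls hp P z.1 z.2, fun _ hz => ⟨U, le_rfl, P, hz, fun _ _ => rfl⟩⟩

/-- The global section `1_{Z→Y}`. -/
def Transfer.unit : Transfer hp ⊤ := Transfer.mk hp 1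

/-- `R` represents `Q` under the isomorphism between the sheaf of `Θ_{Z/Y}`-invariants of
`D_Z / D_Z · Θ_{Z/Y}` and `p⁻¹ D_Y`: the class of `R` is annihilated by the commutator action of
vertical vector fields, and the resulting action of `R` on pull-backs of holomorphic functions from
`Y` is that of `Q`. -/
structure IsLift {U : Opens Z} (R : DiffOp E U) (Q : DiffOp F (img hp U)) : Prop where
  invariant : ∀ (V : Opens Z) (h : V ≤ U) (ξ : DiffOp E V), IsVertical hp ξ →
    Transfer.mk hp (ξ * DiffOp.res h R - DiffOp.res h R * ξ) = 0
  map_pullback : ∀ (V : Opens Z) (h : V ≤ U) (g : Smooth F (img hp V)), g.IsHol →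
    R.app V h (pullback hp V g) = pullback hp V (Q.app (img hp V) (img_mono hp h) g)

/-- `t = s · Q` for the right action of `p⁻¹ D_Y` on `D_{Z→Y}`: locally `s` is the class of some
`P`, and `t` is the class of `P R`, where `R` represents `Q`. -/
def IsRightMul {U : Opens Z} (s : Transfer hp U) (Q : DiffOp F (img hp U))
    (t : Transfer hp U) : Prop :=
  ∀ z ∈ U, ∃ (V : Opens Z) (h : V ≤ U) (P R : DiffOp E V), z ∈ V ∧
    IsLift hp R (DiffOp.res (img_mono hp h) Q) ∧
    Transfer.res hp h s = Transfer.mk hp P ∧ Transfer.res hp h t = Transfer.mk hp (P * R)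

/-- The sections over `U` of the sheaf `Hom(p⁻¹ C^∞_Y, C^∞_Z)` of `ℂ`-linear homomorphisms:
families of linear maps `C^∞(p(V)) → C^∞(V)`, for `V ⊆ U` open, that commute with restrictions.
(As the target is a sheaf, homomorphisms out of the presheaf `V ↦ C^∞(p(V))` and out of the
associated sheaf `p⁻¹ C^∞_Y` are the same.) -/
def pullbackHomSubmodule (U : Opens Z) :
    Submodule ℂ (∀ V : Set.Iic U, Smooth F (img hp V.1) →ₗ[ℂ] Smooth E V.1) where
  carrier := {φ | ∀ (V W : Set.Iic U) (h : W.1 ≤ V.1) (f : Smooth F (img hp V.1)),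
    Smooth.res h (φ V f) = φ W (Smooth.res (img_mono hp h) f)}
  add_mem' {φ ψ} hφ hψ V W h f := by
    change Smooth.res h (φ V f + ψ V f) = φ W _ + ψ W _
    rw [map_add, hφ, hψ]
  zero_mem' _ _ h _ := map_zero (Smooth.res h)
  smul_mem' c φ hφ V W h f := by
    change Smooth.res h (c • φ V f) = c • φ W _
    rw [map_smul, hφ]

/-- The sections over `U` of `Hom(p⁻¹ C^∞_Y, C^∞_Z)`, as a type. -/
def PullbackHom (U : Opens Z) : Type _ := pullbackHomSubmodule hp U

instance (U : Opens Z) : AddCommGroup (PullbackHom hp U) :=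
  inferInstanceAs (AddCommGroup (pullbackHomSubmodule hp U))

/-- Endomorphisms of the sheaf `C^∞_Z` act on the left by composition, `P · φ = P ∘ φ`. -/
instance (U : Opens Z) : Module (SmoothEnd E U) (PullbackHom hp U) where
  smul P φ := ⟨fun V => (P.1 V).comp (φ.1 V), fun V W h f => by
    change Smooth.res h (P.1 V (φ.1 V f)) = P.1 W (φ.1 W _)
    rw [P.2, φ.2]⟩
  one_smul _ := rfl
  mul_smul _ _ _ := rfl
  smul_zero P := Subtype.ext (funext fun V => LinearMap.comp_zero (P.1 V))
  smul_add P φ ψ := Subtype.ext (funext fun V => LinearMap.comp_add (φ.1 V) (ψ.1 V) (P.1 V))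
  add_smul _ _ _ := rfl
  zero_smul _ := rfl

/-- The left action of `D_Z(U)`. -/
instance (U : Opens Z) : Module (DiffOp E U) (PullbackHom hp U) :=
  Module.compHom (PullbackHom hp U) (DiffOp.toEnd (E := E) U).toRingHom

/-- The right action of differential operators on `p(U)`, `φ · Q = φ ∘ Q`. -/
def PullbackHom.rightMul {U : Opens Z} (φ : PullbackHom hp U) (Q : DiffOp F (img hp U)) :
    PullbackHom hp U :=
  ⟨fun V => (φ.1 V).comp (Q.app (img hp V.1) (img_mono hp V.2)), fun V W h f => by
    change Smooth.res h (φ.1 V (Q.app _ _ f)) = φ.1 W (Q.app _ _ _)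
    rw [φ.2]
    exact congrArg (φ.1 W) (Q.1.2 ⟨img hp V.1, img_mono hp V.2⟩ ⟨img hp W.1, img_mono hp W.2⟩
      (img_mono hp h) f)⟩

/-- Restriction of sections of `Hom(p⁻¹ C^∞_Y, C^∞_Z)`. -/
def PullbackHom.res {U V : Opens Z} (h : V ≤ U) (φ : PullbackHom hp U) : PullbackHom hp V :=
  ⟨fun W => φ.1 ⟨W.1, le_trans W.2 h⟩, fun W W' h' f =>
    φ.2 ⟨W.1, le_trans W.2 h⟩ ⟨W'.1, le_trans W'.2 h⟩ h' f⟩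

/-- The global section of `Hom(p⁻¹ C^∞_Y, C^∞_Z)` given by the pull-back of smooth functions. -/
def smoothPullback : PullbackHom hp ⊤ :=
  ⟨fun V => (pullback hp V.1).toLinearMap, fun _ _ _ _ => rfl⟩

/-- Homomorphisms of `(D_Z, p⁻¹ D_Y)`-bimodules `D_{Z→Y} → Hom(p⁻¹ C^∞_Y, C^∞_Z)`: morphisms of
sheaves that are linear for the left action of `D_Z` and compatible with the right action of
`p⁻¹ D_Y` (it suffices to test sections of `p⁻¹ D_Y` over `U` that come from `D_Y(p(U))`, as every
section is locally of this form). -/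
@[ext]
structure BimoduleHom where
  app : ∀ U : Opens Z, Transfer hp U →ₗ[DiffOp E U] PullbackHom hp U
  naturality : ∀ (U V : Opens Z) (h : V ≤ U) (s : Transfer hp U),
    app V (Transfer.res hp h s) = PullbackHom.res hp h (app U s)
  map_rightMul : ∀ (U : Opens Z) (s t : Transfer hp U) (Q : DiffOp F (img hp U)),
    IsRightMul hp s Q t → app U t = PullbackHom.rightMul hp (app U s) Q

end Submersion

end HolD

end

/-! Everything rests on one local equivalence: a holomorphic operator `P` has zero class in
`D_{Z→Y}` exactly when it annihilates the pull-backs of functions from `Y`, and it makes no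
difference whether these are tested with holomorphic or with smooth functions.

In one direction, a vertical field has the form `∑ aᵢ ∂ᵢ` in coordinates where `p` is a linear
projection. The coefficients along the base are its values on base coordinates, hence zero, and the
derivatives along the fibre annihilate every `f ∘ p` with `f` smooth (`IsVertical.app_pullback`). So
`P (f ∘ p)` depends only on the class of `P`, and these local functions glue
(`Transfer.exists_act`); this is the homomorphism.

In the other direction, normal ordering writes `P` as `∑ a_α ∂^α`, with `∂` the base derivatives
only, modulo the left ideal of the vertical derivatives. Testing on `exp ∘ l` for all linear forms
`l` on the base makes the polynomial `∑ a_α(z) l^α` vanish for each `z`, so all `a_α` are zero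
(`SubmersionChart.mem_span_of_app_pullback_eq_zero`, `cls_eq_zero_of_app_pullback`). This gives
injectivity.

For the right action, an explicit lift of `Q` acts as `Q` on all smooth pull-backs. Any other lift
agrees with it on holomorphic pull-backs, so by the equivalence it agrees on smooth ones
(`IsLift.app_pullback`). Existence of `s · Q` is a gluing statement, and its uniqueness follows from
injectivity. The homomorphism is unique because every section is locally `P · 1`. Part (2) is left
linearity, together with the fact that conjugation commutes with pull-back. -/

noncomputable section

namespace HolD

/-! ### Wirtinger derivatives on a complex vector space. -/

section Wirtinger

open Complex Topology

variable {E : Type*} [NormedAddCommGroup E] [NormedSpace ℂ E]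
  {F : Type*} [NormedAddCommGroup F] [NormedSpace ℂ F]

/-- The `(1,0)`-part of the real derivative of `g` in the direction `v`. In coordinates, `wirt eᵢ`
is `∂/∂zᵢ`. -/
def wirt (v : E) (g : E → ℂ) (x : E) : ℂ :=
  (1 / 2 : ℂ) * (fderiv ℝ g x v - I * fderiv ℝ g x (I • v))

theorem wirt_congr {v : E} {g h : E → ℂ} {x : E} (e : g =ᶠ[𝓝 x] h) :
    wirt v g x = wirt v h x := by
  simp only [wirt, e.fderiv_eq]

theorem wirt_of_fderiv_eq_zero {v : E} {g : E → ℂ} {x : E} (h : fderiv ℝ g x = 0) :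
    wirt v g x = 0 := by
  simp [wirt, h]

theorem _root_.ContDiffAt.wirt {v : E} {g : E → ℂ} {x : E} (hg : ContDiffAt ℝ ∞ g x) :
    ContDiffAt ℝ ∞ (wirt v g) x := by
  have h : ContDiffAt ℝ ∞ (fderiv ℝ g) x := hg.fderiv_right (by simp)
  exact contDiffAt_const.mul ((h.clm_apply contDiffAt_const).sub
    (contDiffAt_const.mul (h.clm_apply contDiffAt_const)))

theorem wirt_add {v : E} {g h : E → ℂ} {x : E} (hg : DifferentiableAt ℝ g x)
    (hh : DifferentiableAt ℝ h x) : wirt v (g + h) x = wirt v g x + wirt v h x := by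
  simp only [wirt, fderiv_add hg hh, add_apply]; ring

theorem wirt_mul {v : E} {g h : E → ℂ} {x : E} (hg : DifferentiableAt ℝ g x)
    (hh : DifferentiableAt ℝ h x) :
    wirt v (g * h) x = g x * wirt v h x + wirt v g x * h x := by
  simp only [wirt, fderiv_mul hg hh, add_apply, smul_apply, smul_eq_mul]; ring

/-- Both sides expand into values of the second real derivative, so its symmetry is all that is
needed. -/
theorem wirt_comm {v w : E} {g : E → ℂ} {x : E} (hg : ContDiffAt ℝ ∞ g x) :
    wirt v (wirt w g) x = wirt w (wirt v g) x := by
  have h : DifferentiableAt ℝ (fderiv ℝ g) x :=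
    (hg.fderiv_right (m := ∞) (by simp)).differentiableAt (by simp)
  have key (u a : E) : fderiv ℝ (wirt a g) x u = (1 / 2 : ℂ) *
      (fderiv ℝ (fderiv ℝ g) x u a - I * fderiv ℝ (fderiv ℝ g) x u (I • a)) := by
    have h1 (b : E) : HasFDerivAt (fun y => fderiv ℝ g y b)
        ((ContinuousLinearMap.apply ℝ ℂ b).comp (fderiv ℝ (fderiv ℝ g) x)) x :=
      (ContinuousLinearMap.apply ℝ ℂ b).hasFDerivAt.comp x h.hasFDerivAt
    have h2 := ((h1 a).sub ((h1 (I • a)).const_mul I)).const_mul (1 / 2 : ℂ)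
    have h3 : fderiv ℝ (wirt a g) x = _ := h2.fderiv
    rw [h3]; simp
  have hs : IsSymmSndFDerivAt ℝ g x := hg.isSymmSndFDerivAt
    (by rw [minSmoothness_of_isRCLikeNormedField]
        exact WithTop.coe_le_coe.2 (le_top : (2 : ℕ∞) ≤ ⊤))
  change (1 / 2 : ℂ) * (fderiv ℝ (wirt w g) x v - I * fderiv ℝ (wirt w g) x (I • v))
    = (1 / 2 : ℂ) * (fderiv ℝ (wirt v g) x w - I * fderiv ℝ (wirt v g) x (I • w))
  rw [key, key, key, key, hs.eq v w, hs.eq v (I • w), hs.eq (I • v) w, hs.eq (I • v) (I • w)]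
  ring

theorem wirt_of_differentiableAt {v : E} {g : E → ℂ} {x : E} (hg : DifferentiableAt ℂ g x) :
    wirt v g x = fderiv ℂ g x v := by
  simp only [wirt, hg.fderiv_restrictScalars ℝ, ContinuousLinearMap.coe_restrictScalars', map_smul,
    smul_eq_mul]
  linear_combination (-1 / 2 : ℂ) * fderiv ℂ g x v * I_mul_I

/-- The differential of a conjugate is conjugate-linear, so the two terms of the `(1,0)`-part
cancel. -/
theorem wirt_conj_of_differentiableAt {v : E} {g : E → ℂ} {x : E} (hg : DifferentiableAt ℂ g x) :
    wirt v (fun y => conj (g y)) x = 0 := by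
  have h : fderiv ℝ (fun y => conj (g y)) x
      = (conjCLE : ℂ →L[ℝ] ℂ).comp ((fderiv ℂ g x).restrictScalars ℝ) :=
    ((conjCLE : ℂ →L[ℝ] ℂ).hasFDerivAt.comp x (hg.hasFDerivAt.restrictScalars ℝ)).fderiv
  simp only [wirt, h]
  simp [← mul_assoc]

theorem wirt_comp_clm {v : E} {g : F → ℂ} (M : E →L[ℂ] F) {x : E}
    (hg : DifferentiableAt ℝ g (M x)) :
    wirt v (g ∘ M) x = wirt (M v) g (M x) := by
  have h : fderiv ℝ (g ∘ M) x = (fderiv ℝ g (M x)).comp (M.restrictScalars ℝ) :=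
    (hg.hasFDerivAt.comp x (M.restrictScalars ℝ).hasFDerivAt).fderiv
  simp [wirt, h]

/-- The decomposition of a real linear form into its `(1,0)` and `(0,1)` parts. -/
theorem exists_eq_add_conj (A : E →L[ℝ] ℂ) : ∃ l m : E →L[ℂ] ℂ,
    (∀ v, l v = (1 / 2 : ℂ) * (A v - I * A (I • v))) ∧ ∀ v, A v = l v + conj (m v) := by
  have key (B : E →L[ℝ] ℂ) : ∃ l : E →L[ℂ] ℂ,
      ∀ v, l v = (1 / 2 : ℂ) * (B v - I * B (I • v)) := by
    refine ⟨⟨⟨⟨fun v => (1 / 2 : ℂ) * (B v - I * B (I • v)), fun v w => ?_⟩, fun c v => ?_⟩, ?_⟩,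
      fun v => rfl⟩
    · simp only [smul_add, map_add]; ring
    · have h1 (u : E) : B (c • u) = c.re * B u + c.im * B (I • u) := by
        conv_lhs => rw [← re_add_im c, add_smul, mul_smul, map_add]
        rw [coe_smul c.re u, coe_smul c.im (I • u), map_smul, map_smul, real_smul, real_smul]
      have h2 : B (I • c • v) = c.re * B (I • v) - c.im * B v := by
        rw [smul_comm, h1, smul_smul, I_mul_I]; simp; ring
      simp only [h1, h2, RingHom.id_apply, smul_eq_mul]
      nth_rewrite 5 [← re_add_im c]
      ring_nf
      simp
      ring
    · dsimp; fun_prop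
  obtain ⟨l, hl⟩ := key A
  -- The `(0,1)`-part of `A` is the conjugate of the `(1,0)`-part of `conj ∘ A`.
  obtain ⟨m, hm⟩ := key ((conjCLE : ℂ →L[ℝ] ℂ).comp A)
  refine ⟨l, m, hl, fun v => ?_⟩
  have h2 : conj (2 : ℂ) = 2 := Complex.conj_ofNat 2
  rw [hl, hm]
  simp [h2]
  ring

end Wirtinger

/-! ### Smooth and holomorphic functions in the charts of the maximal atlas. -/

section Charts

open Topology

variable {E : Type*} [NormedAddCommGroup E] [NormedSpace ℂ E]
  {F : Type*} [NormedAddCommGroup F] [NormedSpace ℂ F]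
  {Z : Type*} [TopologicalSpace Z] [ChartedSpace E Z]
  {Y : Type*} [TopologicalSpace Y] [ChartedSpace F Y]

theorem contMDiffAt_real {f : Z → Y} {x : Z} (h : ContMDiffAt 𝓘(ℂ, E) 𝓘(ℂ, F) ω f x) :
    ContMDiffAt 𝓘(ℝ, E) 𝓘(ℝ, F) ∞ f x := by
  obtain ⟨hc, hd⟩ := contMDiffAt_iff.1 h
  exact contMDiffAt_iff.2 ⟨hc, (hd.restrict_scalars ℝ).of_le le_top⟩

/-- The domain of a chart as an open set. -/
abbrev chartDom (φ : OpenPartialHomeomorph Z E) : Opens Z := ⟨φ.source, φ.open_source⟩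

/-- A smooth function written in the chart `φ` (and extended by zero). -/
def Smooth.coord (φ : OpenPartialHomeomorph Z E) {V : Opens Z} (f : Smooth E V) : E → ℂ :=
  Function.extend Subtype.val f.1 0 ∘ φ.symm

variable {φ : OpenPartialHomeomorph Z E} {V : Opens Z}

@[simp]
theorem extend_apply (f : V → ℂ) (z : V) : Function.extend Subtype.val f 0 z.1 = f z :=
  Subtype.val_injective.extend_apply _ _ _

theorem Smooth.coord_apply (f : Smooth E V) (hV : V ≤ chartDom φ) (z : V) :
    f.coord φ (φ z.1) = f.1 z := by
  rw [Smooth.coord, Function.comp_apply, φ.left_inv (hV z.2), extend_apply]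

/-- Turns an identity between functions on the manifold near `z` into an identity of germs at `φ z`,
which is what `fderiv` and `wirt` see. -/
theorem Smooth.coord_eventuallyEq {f : Smooth E V} (hV : V ≤ chartDom φ) {g : E → ℂ} {z : Z}
    (hz : z ∈ V) {W : Opens Z} (hzW : z ∈ W)
    (h : ∀ w (hw : w ∈ V), w ∈ W → f.1 ⟨w, hw⟩ = g (φ w)) :
    f.coord φ =ᶠ[𝓝 (φ z)] g := by
  have h1 : ∀ᶠ x in 𝓝 (φ z), φ.symm x ∈ V ⊓ W := by
    have := φ.continuousAt_symm (φ.map_source (hV hz))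
    rw [ContinuousAt, φ.left_inv (hV hz)] at this
    exact this ((V ⊓ W).2.mem_nhds ⟨hz, hzW⟩)
  filter_upwards [h1, φ.open_target.mem_nhds (φ.map_source (hV hz))] with x hx hx'
  have := h _ hx.1 hx.2
  rw [φ.right_inv hx'] at this
  rw [← this, Smooth.coord, Function.comp_apply]
  exact extend_apply f.1 ⟨_, hx.1⟩

theorem contMDiffAt_extend (f : Smooth E V) (z : V) :
    ContMDiffAt 𝓘(ℝ, E) 𝓘(ℝ, ℂ) ∞ (Function.extend Subtype.val f.1 0) z.1 := by
  refine (contMDiffAt_subtype_iff (U := V) (x := z)).1 ?_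
  exact (f.2 z).congr_of_eventuallyEq (Filter.Eventually.of_forall (extend_apply f.1))

theorem Smooth.IsHol.contMDiffAt_extend {f : Smooth E V} (hf : f.IsHol) (z : V) :
    ContMDiffAt 𝓘(ℂ, E) 𝓘(ℂ, ℂ) ω (Function.extend Subtype.val f.1 0) z.1 := by
  refine (contMDiffAt_subtype_iff (U := V) (x := z)).1 ?_
  exact (hf z).congr_of_eventuallyEq (Filter.Eventually.of_forall (extend_apply f.1))

theorem Smooth.contDiffAt_coord (hφ : φ ∈ IsManifold.maximalAtlas 𝓘(ℂ, E) ω Z)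
    (f : Smooth E V) (hV : V ≤ chartDom φ) (z : V) :
    ContDiffAt ℝ ∞ (f.coord φ) (φ z.1) := by
  rw [← contMDiffAt_iff_contDiffAt]
  have h1 := contMDiffAt_extend f z
  have h2 := contMDiffAt_real
    (contMDiffAt_symm_of_mem_maximalAtlas hφ (φ.map_source (hV z.2)))
  refine ContMDiffAt.comp (I' := 𝓘(ℝ, E)) _ ?_ h2
  rwa [φ.left_inv (hV z.2)]

theorem Smooth.IsHol.contDiffAt_coord (hφ : φ ∈ IsManifold.maximalAtlas 𝓘(ℂ, E) ω Z)
    {f : Smooth E V} (hf : f.IsHol) (hV : V ≤ chartDom φ) (z : V) :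
    ContDiffAt ℂ ω (f.coord φ) (φ z.1) := by
  rw [← contMDiffAt_iff_contDiffAt]
  have h1 := hf.contMDiffAt_extend z
  have h2 := contMDiffAt_symm_of_mem_maximalAtlas hφ (φ.map_source (hV z.2))
  refine ContMDiffAt.comp (I' := 𝓘(ℂ, E)) _ ?_ h2
  rwa [φ.left_inv (hV z.2)]

/-- The smooth function `g ∘ φ` defined by a function `g` of the coordinates. -/
def Smooth.ofCoord (hφ : φ ∈ IsManifold.maximalAtlas 𝓘(ℂ, E) ω Z) (hV : V ≤ chartDom φ)
    (g : E → ℂ) (hg : ∀ z ∈ V, ContDiffAt ℝ ∞ g (φ z)) : Smooth E V :=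
  ⟨fun z => g (φ z.1), fun z => by
    have h := contMDiffAt_real (contMDiffAt_of_mem_maximalAtlas hφ (hV z.2))
    exact contMDiffAt_subtype_iff.2
      ((contMDiffAt_iff_contDiffAt.2 (hg z.1 z.2)).comp (I' := 𝓘(ℝ, E)) z.1 h)⟩

theorem Smooth.isHol_of_coord (hφ : φ ∈ IsManifold.maximalAtlas 𝓘(ℂ, E) ω Z)
    (hV : V ≤ chartDom φ) {f : Smooth E V}
    (hf : ∀ z ∈ V, ContDiffAt ℂ ω (f.coord φ) (φ z)) : f.IsHol := by
  intro z
  have h := contMDiffAt_of_mem_maximalAtlas hφ (hV z.2)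
  have h1 : ContMDiffAt 𝓘(ℂ, E) 𝓘(ℂ, ℂ) ω (fun w : V => f.coord φ (φ w.1)) z :=
    contMDiffAt_subtype_iff.2
      ((contMDiffAt_iff_contDiffAt.2 (hf z.1 z.2)).comp (I' := 𝓘(ℂ, E)) z.1 h)
  exact h1.congr_of_eventuallyEq
    (Filter.Eventually.of_forall fun w => (f.coord_apply hV w).symm)

/-- Links the pointwise condition on vector fields to coordinates. Each direction is the chain rule
for `φ` or its inverse; the forward one passes through the extension by zero because `f` lives on an
open subset with its own charts. -/
theorem mfderiv_eq_zero_iff (hφ : φ ∈ IsManifold.maximalAtlas 𝓘(ℂ, E) ω Z)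
    (f : Smooth E V) (hV : V ≤ chartDom φ) (z : V) :
    mfderiv 𝓘(ℝ, E) 𝓘(ℝ, ℂ) f.1 z = 0 ↔ fderiv ℝ (f.coord φ) (φ z.1) = 0 := by
  have hφ1 := (contMDiffAt_real (contMDiffAt_of_mem_maximalAtlas hφ (hV z.2)))
  constructor
  · intro h
    have h0 : mfderiv 𝓘(ℝ, E) 𝓘(ℝ, ℂ) (Function.extend Subtype.val f.1 0) z.1 = 0 := by
      have h1 := (((f.2 z).mdifferentiableAt (by simp)).hasMFDerivAt)
      rw [h] at h1
      refine HasMFDerivAt.mfderiv ⟨(contMDiffAt_extend f z).continuousAt, ?_⟩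
      have e : writtenInExtChartAt 𝓘(ℝ, E) 𝓘(ℝ, ℂ) z.1 (Function.extend Subtype.val f.1 0)
          =ᶠ[𝓝 (chartAt E z.1 z.1)] writtenInExtChartAt 𝓘(ℝ, E) 𝓘(ℝ, ℂ) z f.1 := by
        filter_upwards [Opens.chartAt_subtype_val_symm_eventuallyEq (H := E) V (x := z)] with x hx
        have : (chartAt E z.1).symm x = ((chartAt E z).symm x : V).1 := hx
        simp [writtenInExtChartAt, this]
      exact HasFDerivWithinAt.congr_of_eventuallyEq h1.2
        (Filter.Eventually.filter_mono nhdsWithin_le_nhds e) e.self_of_nhds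
    have h1 := (contMDiffAt_extend f z).mdifferentiableAt (by simp)
    have h2 := (contMDiffAt_real
      (contMDiffAt_symm_of_mem_maximalAtlas hφ (φ.map_source (hV z.2)))).mdifferentiableAt
      (by simp)
    rw [← φ.left_inv (hV z.2)] at h1
    rw [← mfderiv_eq_fderiv, Smooth.coord, mfderiv_comp _ h1 h2, φ.left_inv (hV z.2), h0]
    exact ContinuousLinearMap.zero_comp _
  · intro h
    have e : f.1 = f.coord φ ∘ (φ ∘ Subtype.val) := by
      funext w; exact (f.coord_apply hV w).symm
    have h1 : MDifferentiableAt 𝓘(ℝ, E) 𝓘(ℝ, E) (φ ∘ Subtype.val : V → E) z :=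
      (contMDiffAt_subtype_iff.2 hφ1).mdifferentiableAt (by simp)
    have h2 : MDifferentiableAt 𝓘(ℝ, E) 𝓘(ℝ, ℂ) (f.coord φ) ((φ ∘ Subtype.val) z) :=
      ((f.contDiffAt_coord hφ hV z).differentiableAt (by simp)).mdifferentiableAt
    rw [e, mfderiv_comp _ h2 h1, mfderiv_eq_fderiv]
    simp only [Function.comp_apply]
    erw [h]
    exact ContinuousLinearMap.zero_comp _

end Charts

/-! ### Evaluation of functions and of operators. -/

section Evaluation

variable {E : Type*} [NormedAddCommGroup E] [NormedSpace ℂ E]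
  {Z : Type*} [TopologicalSpace Z] [ChartedSpace E Z] {U V : Opens Z}

/-- Evaluation of smooth functions at a point. -/
def Smooth.eval (z : V) : Smooth E V →ₐ[ℂ] ℂ where
  toFun f := f.1 z
  map_one' := rfl
  map_mul' _ _ := rfl
  map_zero' := rfl
  map_add' _ _ := rfl
  commutes' _ := rfl

theorem Smooth.eval_apply (z : V) (f : Smooth E V) : Smooth.eval z f = f.1 z := rfl

theorem SmoothEnd.ext {P Q : SmoothEnd E U}
    (h : ∀ V (hV : V ≤ U) (f : Smooth E V) (z : V), (P.app V hV f).1 z = (Q.app V hV f).1 z) :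
    P = Q :=
  Subtype.ext (funext fun V => LinearMap.ext fun f => Smooth.ext (h V.1 V.2 f))

theorem SmoothEnd.res_app (P : SmoothEnd E U) {V W : Opens Z} (hV : V ≤ U) (h : W ≤ V)
    (f : Smooth E V) : Smooth.res h (P.app V hV f) = P.app W (h.trans hV) (Smooth.res h f) :=
  P.2 ⟨V, hV⟩ ⟨W, h.trans hV⟩ h f

/-- Evaluation of operators over `V ≤ U`, as an algebra homomorphism. -/
def SmoothEnd.appHom (V : Opens Z) (hV : V ≤ U) :
    SmoothEnd E U →ₐ[ℂ] Module.End ℂ (Smooth E V) where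
  toFun P := P.app V hV
  map_one' := rfl
  map_mul' _ _ := rfl
  map_zero' := rfl
  map_add' _ _ := rfl
  commutes' _ := rfl

theorem SmoothEnd.appHom_apply (V : Opens Z) (hV : V ≤ U) (P : SmoothEnd E U) :
    SmoothEnd.appHom V hV P = P.app V hV := rfl

theorem SmoothEnd.mul_app (P Q : SmoothEnd E U) (hV : V ≤ U) (f : Smooth E V) :
    (P * Q).app V hV f = P.app V hV (Q.app V hV f) := rfl

theorem SmoothEnd.add_app (P Q : SmoothEnd E U) (hV : V ≤ U) (f : Smooth E V) :
    (P + Q).app V hV f = P.app V hV f + Q.app V hV f := rfl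

theorem mulOp_app (a : Smooth E U) (hV : V ≤ U) (f : Smooth E V) :
    (mulOp a).app V hV f = Smooth.res hV a * f := rfl

end Evaluation

/-! ### Coordinate derivations and the local form of holomorphic vector fields. -/

section ChartDerivations

open Topology

variable {E : Type*} [NormedAddCommGroup E] [NormedSpace ℂ E]
  {Z : Type*} [TopologicalSpace Z] [ChartedSpace E Z]
  {φ : OpenPartialHomeomorph Z E} (hφ : φ ∈ IsManifold.maximalAtlas 𝓘(ℂ, E) ω Z)

theorem Smooth.coord_ofCoord {V : Opens Z} (hV : V ≤ chartDom φ)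
    {g : E → ℂ} (hg : ∀ z ∈ V, ContDiffAt ℝ ∞ g (φ z)) {z : Z} (hz : z ∈ V) :
    (Smooth.ofCoord hφ hV g hg).coord φ =ᶠ[𝓝 (φ z)] g :=
  Smooth.coord_eventuallyEq hV hz hz fun _ _ _ => rfl

theorem Smooth.coord_add {V : Opens Z} (hV : V ≤ chartDom φ) (f g : Smooth E V) {z : Z}
    (hz : z ∈ V) : (f + g).coord φ =ᶠ[𝓝 (φ z)] f.coord φ + g.coord φ :=
  Smooth.coord_eventuallyEq hV hz hz fun w hw _ => by
    rw [Pi.add_apply, f.coord_apply hV ⟨w, hw⟩, g.coord_apply hV ⟨w, hw⟩]; rfl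

theorem Smooth.coord_mul {V : Opens Z} (hV : V ≤ chartDom φ) (f g : Smooth E V) {z : Z}
    (hz : z ∈ V) : (f * g).coord φ =ᶠ[𝓝 (φ z)] f.coord φ * g.coord φ :=
  Smooth.coord_eventuallyEq hV hz hz fun w hw _ => by
    rw [Pi.mul_apply, f.coord_apply hV ⟨w, hw⟩, g.coord_apply hV ⟨w, hw⟩]; rfl

theorem Smooth.coord_conj {V : Opens Z} (hV : V ≤ chartDom φ) (f : Smooth E V) {z : Z}
    (hz : z ∈ V) : f.conj.coord φ =ᶠ[𝓝 (φ z)] fun x => conj (f.coord φ x) :=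
  Smooth.coord_eventuallyEq hV hz hz fun w hw _ => by
    rw [f.coord_apply hV ⟨w, hw⟩]; rfl

theorem Smooth.coord_res {V W : Opens Z} (hV : V ≤ chartDom φ) (h : W ≤ V) (f : Smooth E V)
    {z : Z} (hz : z ∈ W) : (Smooth.res h f).coord φ =ᶠ[𝓝 (φ z)] f.coord φ :=
  Smooth.coord_eventuallyEq (h.trans hV) hz hz fun w hw _ => by
    rw [f.coord_apply hV ⟨w, h hw⟩]; rfl

/-- The holomorphic derivation `∂/∂v` in the coordinates given by the chart `φ`. -/
def chartDeriv (v : E) : SmoothEnd E (chartDom φ) :=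
  ⟨fun V =>
    { toFun := fun f => Smooth.ofCoord hφ V.2 (wirt v (f.coord φ))
        fun z hz => (f.contDiffAt_coord hφ V.2 ⟨z, hz⟩).wirt
      map_add' := fun f g => by
        ext z
        change wirt v _ _ = wirt v _ _ + wirt v _ _
        rw [wirt_congr (Smooth.coord_add V.2 f g z.2), wirt_add
          ((f.contDiffAt_coord hφ V.2 z).differentiableAt (by simp))
          ((g.contDiffAt_coord hφ V.2 z).differentiableAt (by simp))]
      map_smul' := fun c f => by
        ext z
        change wirt v _ _ = c * wirt v _ _
        have e : (c • f).coord φ =ᶠ[𝓝 (φ z.1)] (fun _ => c) * f.coord φ :=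
          Smooth.coord_eventuallyEq V.2 z.2 z.2 fun w hw _ => by
            rw [Pi.mul_apply, f.coord_apply V.2 ⟨w, hw⟩]; rfl
        rw [wirt_congr e, wirt_mul (differentiableAt_const c)
          ((f.contDiffAt_coord hφ V.2 z).differentiableAt (by simp)),
          wirt_of_fderiv_eq_zero (g := fun _ => c) (by simp)]
        simp },
    fun V W h f => by
      ext z
      exact (wirt_congr (Smooth.coord_res V.2 h f z.2)).symm⟩

theorem chartDeriv_app (v : E) {V : Opens Z} (hV : V ≤ chartDom φ) (f : Smooth E V) (z : V) :
    ((chartDeriv hφ v).app V hV f).1 z = wirt v (f.coord φ) (φ z.1) := rfl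

theorem coord_chartDeriv (v : E) {V : Opens Z} (hV : V ≤ chartDom φ) (f : Smooth E V) {z : Z}
    (hz : z ∈ V) :
    ((chartDeriv hφ v).app V hV f).coord φ =ᶠ[𝓝 (φ z)] wirt v (f.coord φ) :=
  Smooth.coord_eventuallyEq hV hz hz fun _ _ _ => rfl

theorem chartDeriv_comm (v w : E) :
    chartDeriv hφ v * chartDeriv hφ w = chartDeriv hφ w * chartDeriv hφ v := by
  refine SmoothEnd.ext fun V hV f z => ?_
  rw [SmoothEnd.mul_app, SmoothEnd.mul_app, chartDeriv_app, chartDeriv_app,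
    wirt_congr (coord_chartDeriv hφ w hV f z.2), wirt_congr (coord_chartDeriv hφ v hV f z.2),
    wirt_comm (f.contDiffAt_coord hφ hV z)]

/-- The Leibniz rule as a commutation relation, which allows coefficients to be moved to the left of
derivatives. -/
theorem chartDeriv_mul_mulOp (v : E) {U : Opens Z} (hU : U ≤ chartDom φ) (a : Smooth E U) :
    SmoothEnd.res hU (chartDeriv hφ v) * mulOp a
      = mulOp a * SmoothEnd.res hU (chartDeriv hφ v)
        + mulOp ((chartDeriv hφ v).app U hU a) := by
  refine SmoothEnd.ext fun V hV f z => ?_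
  change wirt v ((Smooth.res hV a * f).coord φ) (φ z.1)
    = (Smooth.res hV a).1 z * wirt v (f.coord φ) (φ z.1) + wirt v (a.coord φ) (φ z.1) * f.1 z
  rw [wirt_congr (Smooth.coord_mul (hV.trans hU) _ _ z.2), wirt_mul
    (((Smooth.res hV a).contDiffAt_coord hφ (hV.trans hU) z).differentiableAt (by simp))
    ((f.contDiffAt_coord hφ (hV.trans hU) z).differentiableAt (by simp)),
    Smooth.coord_apply _ (hV.trans hU), Smooth.coord_apply _ (hV.trans hU),
    wirt_congr (Smooth.coord_res hU hV a z.2)]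

theorem isHolVectorField_chartDeriv (v : E) : IsHolVectorField (chartDeriv hφ v) where
  map_eq_zero V hV f z h := wirt_of_fderiv_eq_zero ((mfderiv_eq_zero_iff hφ f hV z).1 h)
  map_hol V hV f hf := by
    refine Smooth.isHol_of_coord hφ hV fun z hz => ?_
    have h := hf.contDiffAt_coord hφ hV ⟨z, hz⟩
    have h1 : ContDiffAt ℂ ω (fun x => fderiv ℂ (f.coord φ) x v) (φ z) :=
      (h.fderiv_right (m := ω) (by simp)).clm_apply contDiffAt_const
    refine h1.congr_of_eventuallyEq ((coord_chartDeriv hφ v hV f hz).trans ?_)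
    filter_upwards [h.eventually (by simp)] with x hx
    exact wirt_of_differentiableAt (hx.differentiableAt (by simp))
  map_conj_hol V hV f hf := by
    ext z
    refine (wirt_congr (Smooth.coord_conj hV f z.2)).trans ?_
    exact wirt_conj_of_differentiableAt
      ((hf.contDiffAt_coord hφ hV z).differentiableAt (by simp))

/-- The holomorphic function `g ∘ φ` for `g` holomorphic on the model space. -/
def holFn {V : Opens Z} (hV : V ≤ chartDom φ) (g : E → ℂ) (hg : ContDiff ℂ ω g) : Smooth E V :=
  Smooth.ofCoord hφ hV g fun _ _ => (hg.contDiffAt.restrict_scalars ℝ).of_le le_top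

theorem isHol_holFn {V : Opens Z} (hV : V ≤ chartDom φ) (g : E → ℂ) (hg : ContDiff ℂ ω g) :
    (holFn hφ hV g hg).IsHol :=
  Smooth.isHol_of_coord hφ hV fun _ hz =>
    hg.contDiffAt.congr_of_eventuallyEq (Smooth.coord_ofCoord hφ hV _ hz)

theorem holFn_apply {V : Opens Z} (hV : V ≤ chartDom φ) (g : E → ℂ) (hg : ContDiff ℂ ω g)
    (z : V) : (holFn hφ hV g hg).1 z = g (φ z.1) := rfl

theorem chartDeriv_holFn (v : E) {V : Opens Z} (hV : V ≤ chartDom φ) (g : E → ℂ)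
    (hg : ContDiff ℂ ω g) (z : V) :
    ((chartDeriv hφ v).app V hV (holFn hφ hV g hg)).1 z = fderiv ℂ g (φ z.1) v := by
  rw [chartDeriv_app, ← wirt_of_differentiableAt (hg.contDiffAt.differentiableAt (by simp))]
  exact wirt_congr (Smooth.coord_ofCoord hφ hV _ z.2)

/-- A holomorphic vector field depends only on the `(1,0)`-part of the differential. -/
theorem IsHolVectorField.exists_app_eq {U : Opens Z} (hU : U ≤ chartDom φ) {ξ : SmoothEnd E U}
    (hξ : IsHolVectorField ξ) {V : Opens Z} (hV : V ≤ U) (f : Smooth E V) (z : V) :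
    ∃ l : E →L[ℂ] ℂ, (∀ v, l v = wirt v (f.coord φ) (φ z.1)) ∧
      (ξ.app V hV f).1 z = (ξ.app V hV (holFn hφ (hV.trans hU) l l.contDiff)).1 z := by
  obtain ⟨l, m, hl, hlm⟩ := exists_eq_add_conj (fderiv ℝ (f.coord φ) (φ z.1))
  refine ⟨l, hl, ?_⟩
  have hV' := hV.trans hU
  set L := holFn hφ hV' l l.contDiff
  set M := holFn hφ hV' m m.contDiff
  -- Subtracting the linear `(1,0)`- and `(0,1)`-parts of `df` leaves a function with zero
  -- differential at `z`. The field gives zero there on `g`, and annihilates `M.conj` by its type,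
  -- so only `L` contributes.
  set g : Smooth E V := f - L - M.conj with hg
  have e : g.coord φ =ᶠ[𝓝 (φ z.1)] fun x => f.coord φ x - l x - conj (m x) :=
    Smooth.coord_eventuallyEq hV' z.2 z.2 fun w hw _ => by
      rw [f.coord_apply hV' ⟨w, hw⟩]; rfl
  have h0 : fderiv ℝ (g.coord φ) (φ z.1) = 0 := by
    rw [e.fderiv_eq]
    have h1 := ((f.contDiffAt_coord hφ hV' z).differentiableAt (by simp)).hasFDerivAt
    have h2 : HasFDerivAt (fun x => conj (m x)) _ (φ z.1) :=
      (Complex.conjCLE : ℂ →L[ℝ] ℂ).hasFDerivAt.comp (φ z.1) (m.restrictScalars ℝ).hasFDerivAt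
    have h3 := (h1.sub (l.restrictScalars ℝ).hasFDerivAt).sub h2
    refine h3.fderiv.trans ?_
    ext v
    have := hlm v
    simp only [sub_apply, this]
    simp
  have h1 := hξ.map_eq_zero V hV g z ((mfderiv_eq_zero_iff hφ g hV' z).2 h0)
  rw [hg, map_sub, map_sub, hξ.map_conj_hol V hV M (isHol_holFn hφ hV' _ _), sub_zero] at h1
  exact sub_eq_zero.1 h1

variable [FiniteDimensional ℂ E]

/-- The holomorphic coordinate functions attached to a basis of the model space. -/
def coordFn {ι : Type*} (b : Module.Basis ι ℂ E) {V : Opens Z} (hV : V ≤ chartDom φ) (i : ι) :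
    Smooth E V :=
  holFn hφ hV (b.coord i).toContinuousLinearMap (b.coord i).toContinuousLinearMap.contDiff

theorem isHol_coordFn {ι : Type*} (b : Module.Basis ι ℂ E) {V : Opens Z} (hV : V ≤ chartDom φ)
    (i : ι) : (coordFn hφ b hV i).IsHol := isHol_holFn hφ hV _ _

/-- The expression of a holomorphic vector field in local coordinates. -/
theorem IsHolVectorField.eq_sum {ι : Type*} [Fintype ι] (b : Module.Basis ι ℂ E)
    {U : Opens Z} (hU : U ≤ chartDom φ) {ξ : SmoothEnd E U} (hξ : IsHolVectorField ξ) :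
    ξ = ∑ i, mulOp (ξ.app U le_rfl (coordFn hφ b hU i))
      * SmoothEnd.res hU (chartDeriv hφ (b i)) := by
  refine SmoothEnd.ext fun V hV f z => ?_
  obtain ⟨l, hl, h⟩ := hξ.exists_app_eq hφ hU hV f z
  -- The linear form is a combination of coordinate functions, and its coefficients `l (b i)` are
  -- the derivatives of `f` along `b i`.
  have e : holFn hφ (hV.trans hU) l l.contDiff
      = ∑ i, l (b i) • Smooth.res hV (coordFn hφ b hU i) := by
    ext w
    rw [holFn_apply, ← Smooth.eval_apply w, map_sum]
    conv_lhs => rw [← b.sum_repr (φ w.1), map_sum]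
    refine Finset.sum_congr rfl fun i _ => ?_
    rw [map_smul, map_smul, smul_eq_mul, smul_eq_mul, mul_comm]
    rfl
  rw [h, e, map_sum, ← SmoothEnd.appHom_apply V hV (∑ i, _), map_sum,
    ← Smooth.eval_apply z, map_sum, ← Smooth.eval_apply z, LinearMap.sum_apply, map_sum]
  refine Finset.sum_congr rfl fun i _ => ?_
  rw [map_smul, map_smul, hl, smul_eq_mul, mul_comm, ← ξ.res_app le_rfl hV]
  rfl

end ChartDerivations

/-! ### Normal ordering in a noncommutative algebra. -/

section Algebra

variable {A : Type*} [Ring A] [Algebra ℂ A] {ι κ : Type*}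

/-- Polynomials can be evaluated at a family of commuting elements of a noncommutative algebra. -/
theorem exists_aeval_of_commute (d : ι → A) (hd : ∀ i j, d i * d j = d j * d i) :
    ∃ T : MvPolynomial ι ℂ →ₐ[ℂ] A, ∀ i, T (MvPolynomial.X i) = d i := by
  have hcomm : ∀ a ∈ Set.range d, ∀ b ∈ Set.range d, a * b = b * a := by
    rintro _ ⟨i, rfl⟩ _ ⟨j, rfl⟩
    exact hd i j
  -- The subalgebra generated by commuting elements is commutative, so ordinary polynomial
  -- evaluation applies inside it.
  have hc := Algebra.isMulCommutative_adjoin ℂ hcomm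
  let _ : CommRing (Algebra.adjoin ℂ (Set.range d)) :=
    { (inferInstance : Ring (Algebra.adjoin ℂ (Set.range d))) with mul_comm := hc.is_comm.comm }
  let x : ι → Algebra.adjoin ℂ (Set.range d) :=
    fun i => ⟨d i, Algebra.subset_adjoin (Set.mem_range_self i)⟩
  refine ⟨(Algebra.adjoin ℂ (Set.range d)).val.comp (MvPolynomial.aeval x), fun i => ?_⟩
  simp [x]

/-- Normal form of differential operators modulo the left ideal generated by some of the
derivations. -/
theorem mem_span_sup_span_of_mem_adjoin (O : Subalgebra ℂ A) (d : ι → A) (t : κ → A)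
    (hdt : ∀ i j, t j * d i = d i * t j) (T : MvPolynomial ι ℂ →ₐ[ℂ] A)
    (hT : ∀ i, T (MvPolynomial.X i) = d i)
    (hdO : ∀ i, ∀ a ∈ O, ∃ c ∈ O, d i * a = a * d i + c)
    (htO : ∀ j, ∀ a ∈ O, ∃ c ∈ O, t j * a = a * t j + c) {x : A}
    (hx : x ∈ Algebra.adjoin ℂ (O ∪ Set.range d ∪ Set.range t)) :
    x ∈ Submodule.span ℂ {y | ∃ a ∈ O, ∃ α, y = a * T (MvPolynomial.monomial α 1)} ⊔
      Submodule.span ℂ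
        {y | ∃ s ∈ Algebra.adjoin ℂ (O ∪ Set.range d ∪ Set.range t), ∃ j, y = s * t j} := by
  set S := Algebra.adjoin ℂ ((O : Set A) ∪ Set.range d ∪ Set.range t) with hS
  have hOS {a : A} (ha : a ∈ O) : a ∈ S := Algebra.subset_adjoin (Or.inl (Or.inl ha))
  have hdS (i : ι) : d i ∈ S := Algebra.subset_adjoin (Or.inl (Or.inr ⟨i, rfl⟩))
  have htS (j : κ) : t j ∈ S := Algebra.subset_adjoin (Or.inr ⟨j, rfl⟩)
  have hTS (q : MvPolynomial ι ℂ) : T q ∈ S ∧ ∀ j, t j * T q = T q * t j := by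
    induction q using MvPolynomial.induction_on with
    | C a =>
      have : T (MvPolynomial.C a) = algebraMap ℂ A a := T.commutes a
      rw [this]
      exact ⟨S.algebraMap_mem a, fun j => (Algebra.commutes a (t j)).symm⟩
    | add q r hq hr =>
      rw [map_add]
      exact ⟨add_mem hq.1 hr.1, fun j => by rw [mul_add, add_mul, hq.2, hr.2]⟩
    | mul_X q i hq =>
      rw [map_mul, hT]
      exact ⟨mul_mem hq.1 (hdS i), fun j => by
        rw [← mul_assoc, hq.2, mul_assoc, hdt, mul_assoc]⟩
  set N := Submodule.span ℂ {y | ∃ a ∈ O, ∃ α, y = a * T (MvPolynomial.monomial α 1)}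
  set J := Submodule.span ℂ {y | ∃ s ∈ S, ∃ j, y = s * t j}
  have hN {a : A} (ha : a ∈ O) (α) : a * T (MvPolynomial.monomial α 1) ∈ N ⊔ J :=
    Submodule.mem_sup_left (Submodule.subset_span ⟨a, ha, α, rfl⟩)
  have hJ {s : A} (hs : s ∈ S) (j) : s * t j ∈ N ⊔ J :=
    Submodule.mem_sup_right (Submodule.subset_span ⟨s, hs, j, rfl⟩)
  -- `J` is stable under left multiplication by `S`, so stability of `N ⊔ J` has to be tested on the
  -- generators of `N` only.
  have key : ∀ x, x ∈ S →
      (∀ a ∈ O, ∀ α, x * (a * T (MvPolynomial.monomial α 1)) ∈ N ⊔ J) →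
      ∀ y ∈ N ⊔ J, x * y ∈ N ⊔ J := by
    intro x hxS hx y hy
    have : N ⊔ J ≤ (N ⊔ J).comap (LinearMap.mulLeft ℂ x) := by
      refine sup_le (Submodule.span_le.2 ?_) (Submodule.span_le.2 ?_)
      · rintro _ ⟨a, ha, α, rfl⟩
        exact hx a ha α
      · rintro _ ⟨s, hs, j, rfl⟩
        change x * (s * t j) ∈ N ⊔ J
        rw [← mul_assoc]
        exact hJ (mul_mem hxS hs) j
    exact this hy
  -- It suffices that `N ⊔ J` is stable under left multiplication by `x`, since it contains `1`. For
  -- generators: functions are absorbed by the coefficient, `d i` raises the exponent, and `t j`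
  -- moves past `T` to the far right into `J`; each commutator with a coefficient stays in `N`.
  have main : ∀ y ∈ N ⊔ J, x * y ∈ N ⊔ J := by
    induction hx using Algebra.adjoin_induction with
    | mem x hx =>
      refine key x (Algebra.subset_adjoin hx) fun a ha α => ?_
      obtain (hx | ⟨i, rfl⟩) | ⟨j, rfl⟩ := hx
      · rw [← mul_assoc]
        exact hN (mul_mem hx ha) α
      · obtain ⟨c, hc, h⟩ := hdO i a ha
        have h1 : d i * T (MvPolynomial.monomial α 1)
            = T (MvPolynomial.monomial (Finsupp.single i 1 + α) 1) := by
          rw [← hT, ← map_mul, MvPolynomial.X, MvPolynomial.monomial_mul, one_mul]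
        rw [← mul_assoc, h, add_mul, mul_assoc, h1]
        exact add_mem (hN ha _) (hN hc _)
      · obtain ⟨c, hc, h⟩ := htO j a ha
        rw [← mul_assoc, h, add_mul, mul_assoc, (hTS _).2, ← mul_assoc]
        exact add_mem (hJ (mul_mem (hOS ha) (hTS _).1) j) (hN hc _)
    | algebraMap c =>
      intro y hy
      rw [← Algebra.smul_def]
      exact Submodule.smul_mem _ c hy
    | add u v _ _ hu hv =>
      intro y hy
      rw [add_mul]
      exact add_mem (hu y hy) (hv y hy)
    | mul u v _ _ hu hv =>
      intro y hy
      rw [mul_assoc]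
      exact hu _ (hv y hy)
  have h1 : (1 : A) ∈ N ⊔ J := by
    have := hN (one_mem O) 0
    rwa [one_mul, MvPolynomial.monomial_zero', map_one, map_one] at this
  simpa using main 1 h1

end Algebra

/-! ### Holomorphic coefficients and generators of the operators in a chart. -/

section Holomorphic

variable {E : Type*} [NormedAddCommGroup E] [NormedSpace ℂ E]
  {Z : Type*} [TopologicalSpace Z] [ChartedSpace E Z] {U V : Opens Z}

theorem Smooth.IsHol.add {f g : Smooth E U} (hf : f.IsHol) (hg : g.IsHol) : (f + g).IsHol :=
  fun x => ((contDiff_add (𝕜 := ℂ) (F := ℂ) (n := ω)).contMDiff).contMDiffAt.comp x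
    ((hf x).prodMk_space (hg x))

theorem Smooth.IsHol.mul {f g : Smooth E U} (hf : f.IsHol) (hg : g.IsHol) : (f * g).IsHol :=
  fun x => ((contDiff_mul (𝕜 := ℂ) (𝔸 := ℂ) (n := ω)).contMDiff).contMDiffAt.comp x
    ((hf x).prodMk_space (hg x))

theorem mulOp_add (a b : Smooth E U) : mulOp (a + b) = mulOp a + mulOp b :=
  SmoothEnd.ext fun _ _ _ _ => add_mul _ _ _

variable (E) in
/-- Multiplication operators by holomorphic functions. -/
def holOps (U : Opens Z) : Subalgebra ℂ (SmoothEnd E U) where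
  carrier := {P | ∃ a : Smooth E U, a.IsHol ∧ P = mulOp a}
  mul_mem' := by
    rintro _ _ ⟨a, ha, rfl⟩ ⟨b, hb, rfl⟩
    exact ⟨a * b, ha.mul hb, SmoothEnd.ext fun _ _ _ _ => (mul_assoc _ _ _).symm⟩
  add_mem' := by
    rintro _ _ ⟨a, ha, rfl⟩ ⟨b, hb, rfl⟩
    exact ⟨a + b, ha.add hb, (mulOp_add a b).symm⟩
  algebraMap_mem' c := ⟨algebraMap ℂ _ c, contMDiff_const, rfl⟩

theorem generatedOps_le_diffOpSubalgebra (U : Opens Z) :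
    generatedOps E U ≤ diffOpSubalgebra E U :=
  fun _ hP _ hz => ⟨U, le_rfl, hz, hP⟩

theorem mulOp_mem_generatedOps {a : Smooth E U} (ha : a.IsHol) : mulOp a ∈ generatedOps E U :=
  Algebra.subset_adjoin (Or.inl ⟨a, ha, rfl⟩)

theorem IsHolVectorField.mem_generatedOps {ξ : SmoothEnd E U} (hξ : IsHolVectorField ξ) :
    ξ ∈ generatedOps E U :=
  Algebra.subset_adjoin (Or.inr hξ)

/-- By the local form of a field, whose coefficients are its values on the coordinates and hence
holomorphic, the coordinate derivations suffice as generators. -/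
theorem generatedOps_eq_adjoin [FiniteDimensional ℂ E]
    {φ : OpenPartialHomeomorph Z E} (hφ : φ ∈ IsManifold.maximalAtlas 𝓘(ℂ, E) ω Z)
    {ι : Type*} [Fintype ι] (b : Module.Basis ι ℂ E) (hU : U ≤ chartDom φ) :
    generatedOps E U = Algebra.adjoin ℂ
      (holOps E U ∪ Set.range fun i => SmoothEnd.res hU (chartDeriv hφ (b i))) := by
  refine le_antisymm (Algebra.adjoin_le ?_) (Algebra.adjoin_le ?_)
  · rintro P (hP | hP)
    · exact Algebra.subset_adjoin (Or.inl hP)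
    · rw [IsHolVectorField.eq_sum hφ b hU hP]
      refine sum_mem fun i _ => mul_mem (Algebra.subset_adjoin (Or.inl ⟨_, ?_, rfl⟩))
        (Algebra.subset_adjoin (Or.inr ⟨i, rfl⟩))
      exact hP.map_hol U le_rfl _ (isHol_coordFn hφ b hU i)
  · rintro P (⟨a, ha, rfl⟩ | ⟨i, rfl⟩)
    · exact mulOp_mem_generatedOps ha
    · exact ((isHolVectorField_chartDeriv hφ (b i)).res hU).mem_generatedOps

end Holomorphic

/-! ### Charts in which `p` is linear, and vertical vector fields. -/

section SubmersionCharts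

open Topology

variable {E : Type*} [NormedAddCommGroup E] [NormedSpace ℂ E]
  {F : Type*} [NormedAddCommGroup F] [NormedSpace ℂ F]
  {Z : Type*} [TopologicalSpace Z] [ChartedSpace E Z]
  {Y : Type*} [TopologicalSpace Y] [ChartedSpace F Y]

/-- Charts of `Z` and `Y` in which `p` is a linear projection `E ≃ F × K → F`. -/
structure SubmersionChart (E F K : Type*) [NormedAddCommGroup E] [NormedSpace ℂ E]
    [NormedAddCommGroup F] [NormedSpace ℂ F] [NormedAddCommGroup K] [NormedSpace ℂ K]
    {Z : Type*} [TopologicalSpace Z] [ChartedSpace E Z]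
    {Y : Type*} [TopologicalSpace Y] [ChartedSpace F Y] (p : Z → Y) where
  dom : OpenPartialHomeomorph Z E
  dom_mem : dom ∈ IsManifold.maximalAtlas 𝓘(ℂ, E) ω Z
  cod : OpenPartialHomeomorph Y F
  cod_mem : cod ∈ IsManifold.maximalAtlas 𝓘(ℂ, F) ω Y
  equiv : E ≃L[ℂ] F × K
  map_source : ∀ z ∈ dom.source, p z ∈ cod.source
  cod_apply : ∀ z ∈ dom.source, cod (p z) = (equiv (dom z)).1

variable {p : Z → Y} (hp : IsSubmersion 𝓘(ℂ, E) 𝓘(ℂ, F) ω p)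

theorem exists_submersionChart (x : Z) :
    ∃ c : SubmersionChart E F hp.complement p, x ∈ c.dom.source := by
  have h := hp.isSubmersionOfComplement_complement x
  refine ⟨⟨h.domChart, h.domChart_mem_maximalAtlas, h.codChart, h.codChart_mem_maximalAtlas,
    h.equiv, fun z hz => h.source_subset_preimage_source hz, fun z hz => ?_⟩,
    h.mem_domChart_source⟩
  have hz' : h.domChart z ∈ (h.domChart.extend 𝓘(ℂ, E)).target := by
    simpa using h.domChart.map_source hz
  simpa [h.domChart.left_inv hz] using h.writtenInCharts hz'

theorem pullback_apply {V : Opens Z} (f : Smooth F (img hp V)) (z : V) :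
    (pullback hp V f).1 z = f.1 ⟨p z.1, Set.mem_image_of_mem p z.2⟩ := rfl

theorem res_pullback {V W : Opens Z} (h : W ≤ V) (f : Smooth F (img hp V)) :
    Smooth.res h (pullback hp V f) = pullback hp W (Smooth.res (img_mono hp h) f) := rfl

theorem isHol_pullback {V : Opens Z} {g : Smooth F (img hp V)} (hg : g.IsHol) :
    (pullback hp V g).IsHol := by
  intro z
  have h1 := hg.contMDiffAt_extend ⟨p z.1, Set.mem_image_of_mem p z.2⟩
  have h2 := contMDiffAt_subtype_iff.2 (h1.comp z.1 (hp.contMDiff z.1))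
  exact h2.congr_of_eventuallyEq (Filter.Eventually.of_forall fun w =>
    (extend_apply g.1 ⟨p w.1, Set.mem_image_of_mem p w.2⟩).symm)

namespace SubmersionChart

variable {K : Type*} [NormedAddCommGroup K] [NormedSpace ℂ K] (c : SubmersionChart E F K p)
  {hp}

theorem img_le {V : Opens Z} (hV : V ≤ chartDom c.dom) : img hp V ≤ chartDom c.cod := by
  rintro _ ⟨z, hz, rfl⟩
  exact c.map_source z (hV hz)

/-- The chain rule for a complex-linear projection, which respects `(1,0)`-parts. It therefore holds
for every smooth `f`, which is how statements about holomorphic functions reach smooth ones. -/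
theorem chartDeriv_pullback (v : E) {V : Opens Z} (hV : V ≤ chartDom c.dom)
    (f : Smooth F (img hp V)) :
    (chartDeriv c.dom_mem v).app V hV (pullback hp V f)
      = pullback hp V ((chartDeriv c.cod_mem (c.equiv v).1).app (img hp V) (c.img_le hV) f) := by
  ext z
  let M : E →L[ℂ] F := (ContinuousLinearMap.fst ℂ F K).comp c.equiv.toContinuousLinearMap
  have hM : c.cod (p z.1) = M (c.dom z.1) := c.cod_apply z.1 (hV z.2)
  have e : (pullback hp V f).coord c.dom =ᶠ[𝓝 (c.dom z.1)] f.coord c.cod ∘ M :=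
    Smooth.coord_eventuallyEq hV z.2 z.2 fun w hw _ => by
      have h1 := f.coord_apply (c.img_le hV) ⟨p w, Set.mem_image_of_mem p hw⟩
      rw [c.cod_apply w (hV hw)] at h1
      exact h1.symm
  have h2 := f.contDiffAt_coord c.cod_mem (c.img_le hV) ⟨p z.1, Set.mem_image_of_mem p z.2⟩
  rw [chartDeriv_app, pullback_apply, chartDeriv_app, wirt_congr e, wirt_comp_clm, hM]
  · rfl
  · rw [← hM]
    exact h2.differentiableAt (by simp)

theorem chartDeriv_pullback_eq_zero {v : E} (hv : (c.equiv v).1 = 0) {V : Opens Z}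
    (hV : V ≤ chartDom c.dom) (f : Smooth F (img hp V)) :
    (chartDeriv c.dom_mem v).app V hV (pullback hp V f) = 0 := by
  rw [c.chartDeriv_pullback, hv]
  ext z
  rw [pullback_apply, chartDeriv_app]
  simp only [wirt, smul_zero, map_zero, mul_zero, sub_zero]
  rfl

variable {ι κ : Type*} (b : Module.Basis ι ℂ F) (b' : Module.Basis κ ℂ K)

/-- The basis of `E` adapted to the projection. -/
def basis : Module.Basis (ι ⊕ κ) ℂ E := (b.prod b').map c.equiv.symm.toLinearEquiv

theorem equiv_basis_inl (i : ι) : c.equiv (c.basis b b' (Sum.inl i)) = (b i, 0) := by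
  simp [basis, Module.Basis.prod_apply]

theorem equiv_basis_inr (j : κ) : c.equiv (c.basis b b' (Sum.inr j)) = (0, b' j) := by
  simp [basis, Module.Basis.prod_apply]

theorem basis_coord_inl (i : ι) (x : E) :
    (c.basis b b').coord (Sum.inl i) x = b.coord i (c.equiv x).1 := by
  simp [basis]

theorem coordFn_inl [FiniteDimensional ℂ E] [FiniteDimensional ℂ F] {V : Opens Z}
    (hV : V ≤ chartDom c.dom) (i : ι) :
    coordFn c.dom_mem (c.basis b b') hV (Sum.inl i)
      = pullback hp V (coordFn c.cod_mem b (c.img_le hV) i) := by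
  ext z
  refine (c.basis_coord_inl b b' i (c.dom z.1)).trans ?_
  rw [← c.cod_apply z.1 (hV z.2)]
  rfl

end SubmersionChart

variable {hp} in
/-- A vertical vector field annihilates the pull-backs of all smooth functions. -/
theorem IsVertical.app_pullback [FiniteDimensional ℂ E] [FiniteDimensional ℂ F]
    {U : Opens Z} {ξ : DiffOp E U} (hξ : IsVertical hp ξ) {V : Opens Z} (hV : V ≤ U)
    (f : Smooth F (img hp V)) : ξ.app V hV (pullback hp V f) = 0 := by
  ext z
  obtain ⟨c, hc⟩ := exists_submersionChart hp z.1
  have : FiniteDimensional ℂ (F × hp.complement) :=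
    LinearEquiv.finiteDimensional c.equiv.toLinearEquiv
  have : FiniteDimensional ℂ hp.complement :=
    FiniteDimensional.of_surjective (LinearMap.snd ℂ F hp.complement) LinearMap.snd_surjective
  let W : Opens Z := V ⊓ chartDom c.dom
  have hWV : W ≤ V := inf_le_left
  have hW : W ≤ chartDom c.dom := inf_le_right
  have hξ' := hξ.isHolVectorField.res (hWV.trans hV)
  have h1 : SmoothEnd.res (hWV.trans hV) (DiffOp.toEnd U ξ) = _ := hξ'.eq_sum c.dom_mem
    (c.basis (Module.finBasis ℂ F) (Module.finBasis ℂ hp.complement)) hW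
  have h2 : ξ.app W (hWV.trans hV) (pullback hp W (Smooth.res (img_mono hp hWV) f)) = 0 := by
    change (SmoothEnd.res (hWV.trans hV) (DiffOp.toEnd U ξ)).app W le_rfl _ = 0
    rw [h1, ← SmoothEnd.appHom_apply, map_sum, LinearMap.sum_apply]
    refine Finset.sum_eq_zero fun i _ => ?_
    rw [SmoothEnd.appHom_apply, SmoothEnd.mul_app, mulOp_app]
    -- Along the base the coefficient is `ξ` applied to a pulled-back holomorphic coordinate, hence
    -- zero; along the fibre the derivative annihilates the pull-back.
    rcases i with i | j
    · rw [c.coordFn_inl (hp := hp)]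
      have : (SmoothEnd.res (hWV.trans hV) (DiffOp.toEnd U ξ)).app W le_rfl
          (pullback hp W (coordFn c.cod_mem (Module.finBasis ℂ F) (c.img_le hW) i)) = 0 :=
        hξ.map_pullback W (hWV.trans hV) _ (isHol_coordFn _ _ _ _)
      rw [this, map_zero, zero_mul]
    · have : (SmoothEnd.res hW (chartDeriv c.dom_mem (c.basis (Module.finBasis ℂ F)
          (Module.finBasis ℂ hp.complement) (Sum.inr j)))).app W le_rfl
          (pullback hp W (Smooth.res (img_mono hp hWV) f)) = 0 :=
        c.chartDeriv_pullback_eq_zero (by rw [c.equiv_basis_inr]) hW _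
      rw [this, mul_zero]
  have h3 := ξ.1.res_app hV hWV (pullback hp V f)
  exact congrArg (fun g : Smooth E W => g.1 ⟨z.1, z.2, hc⟩) (h3.trans h2)

end SubmersionCharts

/-! ### Operators annihilating pull-backs of holomorphic functions. -/

section Kernel

variable {E : Type*} [NormedAddCommGroup E] [NormedSpace ℂ E]
  {F : Type*} [NormedAddCommGroup F] [NormedSpace ℂ F]
  {Z : Type*} [TopologicalSpace Z] [ChartedSpace E Z]
  {Y : Type*} [TopologicalSpace Y] [ChartedSpace F Y]
  {p : Z → Y} {hp : IsSubmersion 𝓘(ℂ, E) 𝓘(ℂ, F) ω p}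

theorem aeval_app_eq_smul_of_eigenfunction {U : Opens Z} {ι : Type*}
    {d : ι → SmoothEnd E U} {T : MvPolynomial ι ℂ →ₐ[ℂ] SmoothEnd E U}
    (hT : ∀ i, T (MvPolynomial.X i) = d i) {e : Smooth E U} {l : ι → ℂ}
    (he : ∀ i, (d i).app U le_rfl e = l i • e) (q : MvPolynomial ι ℂ) :
    (T q).app U le_rfl e = MvPolynomial.eval l q • e := by
  induction q using MvPolynomial.induction_on with
  | C a =>
    have : T (MvPolynomial.C a) = algebraMap ℂ _ a := T.commutes a
    rw [this, MvPolynomial.eval_C]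
    rfl
  | add q r hq hr => rw [map_add, SmoothEnd.add_app, hq, hr, map_add, add_smul]
  | mul_X q i hq =>
    rw [map_mul, hT, SmoothEnd.mul_app, he, map_smul, hq, map_mul, MvPolynomial.eval_X, smul_smul,
      mul_comm]

/-- An operator `∑ a_α ∂^α` is zero if it annihilates sufficiently many nowhere vanishing
eigenfunctions of the `∂ᵢ`. -/
theorem eq_zero_of_mem_span_of_eigenfunctions {U : Opens Z} {ι : Type*}
    {d : ι → SmoothEnd E U} {T : MvPolynomial ι ℂ →ₐ[ℂ] SmoothEnd E U}
    (hT : ∀ i, T (MvPolynomial.X i) = d i) {e : (ι → ℂ) → Smooth E U}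
    (he : ∀ l i, (d i).app U le_rfl (e l) = l i • e l) (he0 : ∀ l z, (e l).1 z ≠ 0)
    {P : SmoothEnd E U}
    (hP : P ∈ Submodule.span ℂ
      {y | ∃ a ∈ holOps E U, ∃ α, y = a * T (MvPolynomial.monomial α 1)})
    (hPe : ∀ l, P.app U le_rfl (e l) = 0) : P = 0 := by
  obtain ⟨c, rfl⟩ : ∃ c : (ι →₀ ℕ) →₀ Smooth E U,
      P = c.sum fun α a => mulOp a * T (MvPolynomial.monomial α 1) := by
    clear hPe
    have h0 (α) : mulOp (0 : Smooth E U) * T (MvPolynomial.monomial α 1) = 0 :=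
      SmoothEnd.ext fun V hV f z => zero_mul _
    induction hP using Submodule.span_induction with
    | mem y hy =>
      obtain ⟨_, ⟨a, _, rfl⟩, α, rfl⟩ := hy
      exact ⟨Finsupp.single α a, by rw [Finsupp.sum_single_index (h0 α)]⟩
    | zero => exact ⟨0, rfl⟩
    | add x y _ _ hx hy =>
      obtain ⟨c, rfl⟩ := hx
      obtain ⟨c', rfl⟩ := hy
      exact ⟨c + c', (Finsupp.sum_add_index' h0 fun α a b => by rw [mulOp_add, add_mul]).symm⟩
    | smul k x _ hx =>
      obtain ⟨c, rfl⟩ := hx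
      refine ⟨k • c, ?_⟩
      rw [Finsupp.sum_smul_index' h0, Finsupp.smul_sum]
      refine Finsupp.sum_congr fun α _ => ?_
      exact SmoothEnd.ext fun V hV f z => (mul_assoc k _ _).symm
  have hc : c = 0 := by
    ext α z
    -- The symbol of `P` with coefficients frozen at `z`: `P (e l)` has the value `q(l) * e l z`
    -- there, so `q` vanishes at every point `l`.
    let q : MvPolynomial ι ℂ := c.sum fun α a => MvPolynomial.monomial α (a.1 z)
    have hq : q = 0 := by
      refine MvPolynomial.funext fun l => ?_
      have h1 := congrArg (Smooth.eval z) (hPe l)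
      rw [← SmoothEnd.appHom_apply, map_zero, Finsupp.sum, map_sum, LinearMap.sum_apply,
        map_sum] at h1
      have h2 : MvPolynomial.eval l q * (e l).1 z = 0 := by
        rw [← h1, map_finsuppSum, Finsupp.sum, Finset.sum_mul]
        refine Finset.sum_congr rfl fun α _ => ?_
        rw [SmoothEnd.appHom_apply, SmoothEnd.mul_app, mulOp_app, map_mul,
          aeval_app_eq_smul_of_eigenfunction hT (he l), map_smul, MvPolynomial.eval_monomial,
          MvPolynomial.eval_monomial, one_mul, smul_eq_mul, mul_assoc]
        rfl
      rw [map_zero]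
      exact (mul_eq_zero.1 h2).resolve_right (he0 l z)
    have : MvPolynomial.coeff α q = (c α).1 z := by
      classical
      simp only [q, Finsupp.sum, MvPolynomial.coeff_sum, MvPolynomial.coeff_monomial]
      rw [Finset.sum_ite_eq' c.support α fun β => (c β).1 z, ite_eq_left_iff]
      intro h
      rw [Finsupp.notMem_support_iff.1 h]
      rfl
    rw [← this, hq]
    rfl
  rw [hc, Finsupp.sum_zero_index]

variable [FiniteDimensional ℂ E] [FiniteDimensional ℂ F]

/-- Normal ordering splits `P` into `n`, involving base derivatives only, and `j` in the left ideal
of the vertical ones. As `j` annihilates pull-backs, so does `n` on holomorphic functions, and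
exponentials then force `n = 0`. -/
theorem SubmersionChart.mem_span_of_app_pullback_eq_zero
    {K : Type*} [NormedAddCommGroup K] [NormedSpace ℂ K] (c : SubmersionChart E F K p)
    {U : Opens Z} (hU : U ≤ chartDom c.dom) {P : SmoothEnd E U} (hP : P ∈ generatedOps E U)
    (h : ∀ g : Smooth F (img hp U), g.IsHol → P.app U le_rfl (pullback hp U g) = 0) :
    P ∈ Submodule.span ℂ {y | ∃ s ∈ generatedOps E U, ∃ v, (c.equiv v).1 = 0 ∧
      y = s * SmoothEnd.res hU (chartDeriv c.dom_mem v)} := by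
  have : FiniteDimensional ℂ (F × K) := LinearEquiv.finiteDimensional c.equiv.toLinearEquiv
  have : FiniteDimensional ℂ K :=
    FiniteDimensional.of_surjective (LinearMap.snd ℂ F K) LinearMap.snd_surjective
  let b := Module.finBasis ℂ F
  let b' := Module.finBasis ℂ K
  let D : E → SmoothEnd E U := fun v => SmoothEnd.res hU (chartDeriv c.dom_mem v)
  let d := fun i => D (c.basis b b' (Sum.inl i))
  let t := fun j => D (c.basis b b' (Sum.inr j))
  have hD (v w : E) : D v * D w = D w * D v := by
    simp only [D]
    rw [← map_mul, chartDeriv_comm, map_mul]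
  have hDO (v : E) : ∀ a ∈ holOps E U, ∃ c ∈ holOps E U, D v * a = a * D v + c := by
    rintro _ ⟨a, ha, rfl⟩
    exact ⟨_, ⟨_, (isHolVectorField_chartDeriv c.dom_mem v).map_hol U hU a ha, rfl⟩,
      chartDeriv_mul_mulOp c.dom_mem v hU a⟩
  obtain ⟨T, hT⟩ := exists_aeval_of_commute d fun _ _ => hD _ _
  have hG : generatedOps E U
      = Algebra.adjoin ℂ ((holOps E U : Set _) ∪ Set.range d ∪ Set.range t) := by
    rw [generatedOps_eq_adjoin c.dom_mem (c.basis b b') hU, Set.union_assoc]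
    congr 2
    ext x
    simp [d, t, D]
  rw [hG] at hP
  obtain ⟨n, hn, j, hj, rfl⟩ := Submodule.mem_sup.1 (mem_span_sup_span_of_mem_adjoin (holOps E U)
    d t (fun _ _ => hD _ _) T hT (fun _ => hDO _) (fun _ => hDO _) hP)
  rw [← hG] at hj
  have hj' : j ∈ Submodule.span ℂ {y | ∃ s ∈ generatedOps E U, ∃ v, (c.equiv v).1 = 0 ∧
      y = s * SmoothEnd.res hU (chartDeriv c.dom_mem v)} := by
    refine Submodule.span_mono ?_ hj
    rintro _ ⟨s, hs, j, rfl⟩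
    exact ⟨s, hs, _, by rw [c.equiv_basis_inr], rfl⟩
  have hj0 (g : Smooth F (img hp U)) : j.app U le_rfl (pullback hp U g) = 0 := by
    clear h hj hP
    induction hj' using Submodule.span_induction with
    | mem y hy =>
      obtain ⟨s, _, v, hv, rfl⟩ := hy
      refine Eq.trans ?_ (map_zero (s.app U le_rfl))
      exact congrArg (s.app U le_rfl) (c.chartDeriv_pullback_eq_zero hv hU g)
    | zero => rfl
    | add x y _ _ hx hy => rw [SmoothEnd.add_app, hx, hy, add_zero]
    | smul k x _ hx =>
      change k • x.app U le_rfl (pullback hp U g) = 0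
      rw [hx, smul_zero]
  -- The exponential of the linear form with value `l i` on `b i`: nowhere zero, and an
  -- eigenfunction of each base derivative with eigenvalue `l i`.
  let ex : (Fin (Module.finrank ℂ F) → ℂ) → F → ℂ :=
    fun l x => Complex.exp ((b.constr ℂ l).toContinuousLinearMap x)
  have hex (l) : ContDiff ℂ ω (ex l) :=
    Complex.contDiff_exp.comp (ContinuousLinearMap.contDiff _)
  have hn0 : n = 0 := by
    refine eq_zero_of_mem_span_of_eigenfunctions hT
      (e := fun l => pullback hp U (holFn c.cod_mem (c.img_le hU) (ex l) (hex l)))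
      (fun l i => ?_) (fun l z => Complex.exp_ne_zero _) hn fun l => ?_
    · refine (c.chartDeriv_pullback _ hU _).trans ?_
      rw [c.equiv_basis_inl, ← map_smul]
      congr 1
      ext y
      rw [chartDeriv_holFn]
      have h1 : HasFDerivAt (ex l) _ (c.cod y.1) :=
        (ContinuousLinearMap.hasFDerivAt (b.constr ℂ l).toContinuousLinearMap).cexp
      rw [h1.fderiv]
      have h2 : (b.constr ℂ l) (b i) = l i := b.constr_basis ℂ l i
      refine Eq.trans ?_ (mul_comm (ex l (c.cod y.1)) (l i))
      rw [← h2]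
      rfl
    · have := h _ (isHol_holFn c.cod_mem (c.img_le hU) (ex l) (hex l))
      rwa [SmoothEnd.add_app, hj0, add_zero] at this
  rw [hn0, zero_add]
  exact hj'

end Kernel

/-! ### Representatives of germs of operators. -/

section Germs

variable {E : Type*} [NormedAddCommGroup E] [NormedSpace ℂ E]
  {Z : Type*} [TopologicalSpace Z] [ChartedSpace E Z]

theorem exists_eq_germ {z : Z} (x : DStalk E z) :
    ∃ (U : Opens Z) (hz : z ∈ U) (P : DiffOp E U), x = germ hz P := by
  obtain ⟨⟨U, P⟩, rfl⟩ := Quotient.exists_rep x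
  exact ⟨(OrderDual.ofDual U).1, (OrderDual.ofDual U).2, P, rfl⟩

theorem exists_res_eq_of_germ_eq {z : Z} {U V : Opens Z} (hU : z ∈ U) (hV : z ∈ V)
    {P : DiffOp E U} {Q : DiffOp E V} (h : germ hU P = germ hV Q) :
    ∃ (W : Opens Z) (hWU : W ≤ U) (hWV : W ≤ V), z ∈ W ∧ DiffOp.res hWU P = DiffOp.res hWV Q := by
  obtain ⟨W, h1, h2, e⟩ := Quotient.exact h
  exact ⟨(OrderDual.ofDual W).1, h1, h2, (OrderDual.ofDual W).2, e⟩

theorem DiffOp.mul_app {U V : Opens Z} (P Q : DiffOp E U) (hV : V ≤ U) (f : Smooth E V) :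
    (P * Q).app V hV f = P.app V hV (Q.app V hV f) := rfl

theorem DiffOp.add_app {U V : Opens Z} (P Q : DiffOp E U) (hV : V ≤ U) (f : Smooth E V) :
    (P + Q).app V hV f = P.app V hV f + Q.app V hV f := rfl

theorem DiffOp.sub_app {U V : Opens Z} (P Q : DiffOp E U) (hV : V ≤ U) (f : Smooth E V) :
    (P - Q).app V hV f = P.app V hV f - Q.app V hV f := rfl

theorem DiffOp.res_app {U V W : Opens Z} (P : DiffOp E U) (hV : V ≤ U) (hW : W ≤ V)
    (f : Smooth E W) : (DiffOp.res hV P).app W hW f = P.app W (hW.trans hV) f := rfl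

theorem DiffOp.smoothRes_app {U V W : Opens Z} (P : DiffOp E U) (hV : V ≤ U) (h : W ≤ V)
    (f : Smooth E V) : Smooth.res h (P.app V hV f) = P.app W (h.trans hV) (Smooth.res h f) :=
  P.1.res_app hV h f

end Germs

/-! ### Lifts of operators from the base, and the vanishing criterion in `D_{Z→Y}`. -/

section Transfer

variable {E : Type*} [NormedAddCommGroup E] [NormedSpace ℂ E]
  {F : Type*} [NormedAddCommGroup F] [NormedSpace ℂ F] [FiniteDimensional ℂ F]
  {Z : Type*} [TopologicalSpace Z] [ChartedSpace E Z]
  {Y : Type*} [TopologicalSpace Y] [ChartedSpace F Y]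
  {p : Z → Y} {hp : IsSubmersion 𝓘(ℂ, E) 𝓘(ℂ, F) ω p}

/-- Operators on the base lift to operators on the source of a submersion chart. -/
theorem SubmersionChart.exists_lift
    {K : Type*} [NormedAddCommGroup K] [NormedSpace ℂ K] (c : SubmersionChart E F K p)
    {U : Opens Z} (hU : U ≤ chartDom c.dom) {Q : SmoothEnd F (img hp U)}
    (hQ : Q ∈ generatedOps F (img hp U)) :
    ∃ R ∈ generatedOps E U, ∀ (V : Opens Z) (hV : V ≤ U) (f : Smooth F (img hp V)),
      R.app V hV (pullback hp V f)
        = pullback hp V (Q.app (img hp V) (img_mono hp hV) f) := by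
  rw [generatedOps_eq_adjoin c.cod_mem (Module.finBasis ℂ F) (c.img_le hU)] at hQ
  induction hQ using Algebra.adjoin_induction with
  | mem Q hQ =>
    obtain ⟨a, ha, rfl⟩ | ⟨i, rfl⟩ := hQ
    · exact ⟨mulOp (pullback hp U a), mulOp_mem_generatedOps (isHol_pullback hp ha),
        fun V hV f => rfl⟩
    -- A base derivation lifts to the derivation along the vector with the same base component and
    -- zero fibre component.
    · refine ⟨_, ((isHolVectorField_chartDeriv c.dom_mem
        (c.equiv.symm (Module.finBasis ℂ F i, 0))).res hU).mem_generatedOps, fun V hV f => ?_⟩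
      refine (c.chartDeriv_pullback _ (hV.trans hU) f).trans ?_
      rw [c.equiv.apply_symm_apply]
      rfl
  | algebraMap k =>
    exact ⟨_, (generatedOps E U).algebraMap_mem k, fun V hV f => rfl⟩
  | add Q Q' _ _ hQ hQ' =>
    obtain ⟨R, hR, h⟩ := hQ
    obtain ⟨R', hR', h'⟩ := hQ'
    refine ⟨R + R', add_mem hR hR', fun V hV f => ?_⟩
    rw [SmoothEnd.add_app, SmoothEnd.add_app, h, h', map_add]
  | mul Q Q' _ _ hQ hQ' =>
    obtain ⟨R, hR, h⟩ := hQ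
    obtain ⟨R', hR', h'⟩ := hQ'
    refine ⟨R * R', mul_mem hR hR', fun V hV f => ?_⟩
    rw [SmoothEnd.mul_app, SmoothEnd.mul_app, h', h]

theorem exists_lift {U : Opens Z} (Q : DiffOp F (img hp U)) {z : Z} (hz : z ∈ U) :
    ∃ (V : Opens Z) (hV : V ≤ U) (R : DiffOp E V), z ∈ V ∧
      ∀ (W : Opens Z) (hW : W ≤ V) (f : Smooth F (img hp W)),
        R.app W hW (pullback hp W f)
          = pullback hp W (Q.app (img hp W) (img_mono hp (hW.trans hV)) f) := by
  obtain ⟨c, hc⟩ := exists_submersionChart hp z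
  obtain ⟨N, hN, hzN, hQN⟩ := Q.2 (p z) (Set.mem_image_of_mem p hz)
  -- Small enough for the submersion chart to exist on `V` and for `Q` to be a polynomial expression
  -- in functions and fields on the image of `V`.
  let V : Opens Z := U ⊓ chartDom c.dom ⊓ ⟨p ⁻¹' N, N.2.preimage hp.contMDiff.continuous⟩
  have hVU : V ≤ U := inf_le_left.trans inf_le_left
  have hVc : V ≤ chartDom c.dom := inf_le_left.trans inf_le_right
  have hVN : img hp V ≤ N := by
    rintro _ ⟨w, hw, rfl⟩
    exact hw.2
  obtain ⟨R, hR, h⟩ := c.exists_lift hVc (generatedOps_res hVN hQN)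
  exact ⟨V, hVU, ⟨R, generatedOps_le_diffOpSubalgebra V hR⟩, ⟨⟨hz, hc⟩, hzN⟩,
    fun W hW f => h W hW f⟩

variable [FiniteDimensional ℂ E]

/-- Operators that annihilate pull-backs of holomorphic functions vanish in `D_{Z→Y}`. -/
theorem cls_eq_zero_of_app_pullback {U : Opens Z} (P : DiffOp E U) {z : Z} (hz : z ∈ U)
    (h : ∀ (V : Opens Z) (hV : V ≤ U) (g : Smooth F (img hp V)), g.IsHol →
      P.app V hV (pullback hp V g) = 0) : cls hp P z hz = 0 := by
  obtain ⟨c, hc⟩ := exists_submersionChart hp z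
  obtain ⟨V, hVU, hzV, hPV⟩ := P.2 z hz
  let W : Opens Z := V ⊓ chartDom c.dom
  have hWV : W ≤ V := inf_le_left
  have hW : W ≤ chartDom c.dom := inf_le_right
  have hzW : z ∈ W := ⟨hzV, hc⟩
  have hspan := c.mem_span_of_app_pullback_eq_zero (hp := hp) hW (generatedOps_res hWV hPV)
    fun g hg => h W (hWV.trans hVU) g hg
  -- Passes from endomorphisms to germs: the derivations along `v` with zero base component are
  -- vertical fields, so these products have germs in the stalk ideal.
  have key : ∀ x ∈ Submodule.span ℂ {y | ∃ s ∈ generatedOps E W, ∃ v, (c.equiv v).1 = 0 ∧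
      y = s * SmoothEnd.res hW (chartDeriv c.dom_mem v)}, ∃ X : DiffOp E W, X.1 = x ∧
      germ hzW X ∈ verticalIdeal hp z := by
    intro x hx
    induction hx using Submodule.span_induction with
    | mem y hy =>
      obtain ⟨s, hs, v, hv, rfl⟩ := hy
      have hD := (isHolVectorField_chartDeriv c.dom_mem v).res hW
      let S : DiffOp E W := ⟨s, generatedOps_le_diffOpSubalgebra W hs⟩
      let D : DiffOp E W := ⟨_, generatedOps_le_diffOpSubalgebra W hD.mem_generatedOps⟩
      refine ⟨S * D, rfl, ?_⟩
      rw [map_mul]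
      refine Submodule.smul_mem _ (germ hzW S) (Submodule.subset_span ⟨W, hzW, D, ⟨hD, ?_⟩, rfl⟩)
      exact fun V' hV' g _ => c.chartDeriv_pullback_eq_zero hv (hV'.trans hW) g
    | zero => exact ⟨0, rfl, by rw [map_zero]; exact zero_mem _⟩
    | add x y _ _ hx hy =>
      obtain ⟨X, rfl, hX⟩ := hx
      obtain ⟨X', rfl, hX'⟩ := hy
      exact ⟨X + X', rfl, by rw [map_add]; exact add_mem hX hX'⟩
    | smul k x _ hx =>
      obtain ⟨X, rfl, hX⟩ := hx
      refine ⟨k • X, rfl, ?_⟩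
      rw [Algebra.smul_def, map_mul]
      exact Submodule.smul_mem _ (germ hzW (algebraMap ℂ (DiffOp E W) k)) hX
  obtain ⟨X, hX, hX'⟩ := key _ hspan
  have e : X = DiffOp.res (hWV.trans hVU) P := Subtype.ext hX
  rw [← cls_res hp (hWV.trans hVU) P z hzW, ← e]
  exact (Submodule.Quotient.mk_eq_zero _).2 hX'

/-- Operators that vanish in `D_{Z→Y}` annihilate, locally, pull-backs of smooth functions. -/
theorem exists_app_pullback_eq_zero {U : Opens Z} {P : DiffOp E U} {z : Z} {hz : z ∈ U}
    (h : cls hp P z hz = 0) : ∃ (V : Opens Z) (hV : V ≤ U), z ∈ V ∧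
      ∀ (W : Opens Z) (hW : W ≤ V) (f : Smooth F (img hp W)),
        P.app W (hW.trans hV) (pullback hp W f) = 0 := by
  -- The ideal is one of germs, so the induction produces some representative annihilating
  -- pull-backs; it agrees with `P` after shrinking.
  have key : ∀ x ∈ verticalIdeal hp z, ∃ (U : Opens Z) (hz : z ∈ U) (P : DiffOp E U),
      x = germ hz P ∧ ∀ (W : Opens Z) (hW : W ≤ U) (f : Smooth F (img hp W)),
        P.app W hW (pullback hp W f) = 0 := by
    intro x hx
    induction hx using Submodule.span_induction with
    | mem x hx =>
      obtain ⟨U, hz, ξ, hξ, rfl⟩ := hx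
      exact ⟨U, hz, ξ, rfl, fun W hW f => hξ.app_pullback hW f⟩
    | zero => exact ⟨⊤, trivial, 0, (map_zero _).symm, fun _ _ _ => rfl⟩
    | add x y _ _ hx hy =>
      obtain ⟨U, hz, P, rfl, hP⟩ := hx
      obtain ⟨V, hz', Q, rfl, hQ⟩ := hy
      have hU : U ⊓ V ≤ U := inf_le_left
      have hV : U ⊓ V ≤ V := inf_le_right
      have hzW : z ∈ U ⊓ V := ⟨hz, hz'⟩
      refine ⟨U ⊓ V, hzW, DiffOp.res hU P + DiffOp.res hV Q, ?_, fun W hW f => ?_⟩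
      · rw [map_add, germ_res, germ_res]
      · rw [DiffOp.add_app, DiffOp.res_app, DiffOp.res_app, hP, hQ, add_zero]
    | smul a x _ hx =>
      obtain ⟨U, hz, P, rfl, hP⟩ := hx
      obtain ⟨V, hz', A, rfl⟩ := exists_eq_germ a
      have hU : U ⊓ V ≤ U := inf_le_left
      have hV : U ⊓ V ≤ V := inf_le_right
      have hzW : z ∈ U ⊓ V := ⟨hz, hz'⟩
      refine ⟨U ⊓ V, hzW, DiffOp.res hV A * DiffOp.res hU P, ?_, fun W hW f => ?_⟩
      · rw [map_mul, germ_res, germ_res, smul_eq_mul]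
      · rw [DiffOp.mul_app, DiffOp.res_app P, hP, map_zero]
  obtain ⟨V, hz', P', e, hP'⟩ := key _ ((Submodule.Quotient.mk_eq_zero _).1 h)
  obtain ⟨W, hWU, hWV, hzW, e⟩ := exists_res_eq_of_germ_eq hz hz' e
  refine ⟨W, hWU, hzW, fun W' hW' f => ?_⟩
  rw [← DiffOp.res_app P hWU hW', e, DiffOp.res_app, hP']

/-- `R` maps pull-backs to pull-backs, which vertical fields annihilate. Hence the commutator
annihilates pull-backs and its class is zero. -/
theorem isLift_of_app_pullback {U : Opens Z} {R : DiffOp E U} {Q : DiffOp F (img hp U)}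
    (h : ∀ (W : Opens Z) (hW : W ≤ U) (f : Smooth F (img hp W)),
      R.app W hW (pullback hp W f) = pullback hp W (Q.app (img hp W) (img_mono hp hW) f)) :
    IsLift hp R Q where
  invariant V hV ξ hξ := by
    refine Subtype.ext (funext fun z => cls_eq_zero_of_app_pullback _ z.2 fun W hW g _ => ?_)
    rw [DiffOp.sub_app, DiffOp.mul_app, DiffOp.mul_app, DiffOp.res_app, h, hξ.app_pullback,
      hξ.app_pullback, map_zero, sub_zero]
  map_pullback V hV g _ := h V hV g

/-- A lift of `Q` acts on the pull-backs of all smooth functions as `Q`. -/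
theorem IsLift.app_pullback {U : Opens Z} {R : DiffOp E U} {Q : DiffOp F (img hp U)}
    (hR : IsLift hp R Q) {W : Opens Z} (hW : W ≤ U) (f : Smooth F (img hp W)) :
    R.app W hW (pullback hp W f) = pullback hp W (Q.app (img hp W) (img_mono hp hW) f) := by
  ext z
  obtain ⟨V, hV, R', hzV, hR'⟩ := exists_lift Q (hW z.2)
  -- `R` is controlled on holomorphic functions only, while the explicit lift `R'` is controlled on
  -- smooth ones. Their difference has zero class, so near `z` it annihilates smooth pull-backs as
  -- well.
  have h0 : cls hp (DiffOp.res hV R - R') z.1 hzV = 0 :=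
    cls_eq_zero_of_app_pullback _ _ fun N hN g hg => by
      rw [DiffOp.sub_app, DiffOp.res_app, hR', hR.map_pullback _ _ _ hg, sub_self]
  obtain ⟨V', hV', hzV', h⟩ := exists_app_pullback_eq_zero h0
  let N : Opens Z := W ⊓ V'
  have hNW : N ≤ W := inf_le_left
  have hNV' : N ≤ V' := inf_le_right
  have h1 := h N hNV' (Smooth.res (img_mono hp hNW) f)
  rw [DiffOp.sub_app, DiffOp.res_app, hR', sub_eq_zero] at h1
  have h2 : Smooth.res hNW (R.app W hW (pullback hp W f))
      = Smooth.res hNW (pullback hp W (Q.app (img hp W) (img_mono hp hW) f)) := by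
    rw [DiffOp.smoothRes_app, res_pullback, h1, res_pullback, DiffOp.smoothRes_app]
  exact congrArg (fun g : Smooth E N => g.1 ⟨z.1, z.2, hzV'⟩) h2

end Transfer

/-! ### The action of `D_{Z→Y}` on smooth functions of the base. -/

section Action

variable {E : Type*} [NormedAddCommGroup E] [NormedSpace ℂ E]
  {F : Type*} [NormedAddCommGroup F] [NormedSpace ℂ F]
  {Z : Type*} [TopologicalSpace Z] [ChartedSpace E Z]
  {Y : Type*} [TopologicalSpace Y] [ChartedSpace F Y]
  {p : Z → Y} {hp : IsSubmersion 𝓘(ℂ, E) 𝓘(ℂ, F) ω p}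

theorem Smooth.ext_of_res {V : Opens Z} {f g : Smooth E V}
    (h : ∀ z ∈ V, ∃ (N : Opens Z) (hN : N ≤ V), z ∈ N ∧ Smooth.res hN f = Smooth.res hN g) :
    f = g := by
  ext z
  obtain ⟨N, hN, hz, e⟩ := h z.1 z.2
  exact congrArg (fun g : Smooth E N => g.1 ⟨z.1, hz⟩) e

theorem PullbackHom.ext {U : Opens Z} {φ ψ : PullbackHom hp U}
    (h : ∀ (V : Opens Z) (hV : V ≤ U) (f : Smooth F (img hp V)),
      φ.1 ⟨V, hV⟩ f = ψ.1 ⟨V, hV⟩ f) : φ = ψ :=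
  Subtype.ext (funext fun V => LinearMap.ext fun f => h V.1 V.2 f)

theorem Transfer.mk_add {U : Opens Z} (P Q : DiffOp E U) :
    Transfer.mk hp (P + Q) = Transfer.mk hp P + Transfer.mk hp Q :=
  Subtype.ext (funext fun z => cls_add hp P Q z.1 z.2)

theorem Transfer.mk_mul {U : Opens Z} (P Q : DiffOp E U) :
    Transfer.mk hp (P * Q) = P • Transfer.mk hp Q :=
  Subtype.ext (funext fun z => cls_mul hp P Q z.1 z.2)

theorem Transfer.res_mk {U V : Opens Z} (h : V ≤ U) (P : DiffOp E U) :
    Transfer.res hp h (Transfer.mk hp P) = Transfer.mk hp (DiffOp.res h P) :=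
  Subtype.ext (funext fun z => (cls_res hp h P z.1 z.2).symm)

theorem Transfer.res_add {U V : Opens Z} (h : V ≤ U) (s t : Transfer hp U) :
    Transfer.res hp h (s + t) = Transfer.res hp h s + Transfer.res hp h t := rfl

theorem Transfer.res_smul {U V : Opens Z} (h : V ≤ U) (R : DiffOp E U) (s : Transfer hp U) :
    Transfer.res hp h (R • s) = DiffOp.res h R • Transfer.res hp h s := by
  refine Subtype.ext (funext fun z => ?_)
  change germ (h z.2) R • s.1 ⟨z.1, h z.2⟩ = germ z.2 (DiffOp.res h R) • s.1 ⟨z.1, h z.2⟩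
  rw [germ_res]

/-- Sections of `D_{Z→Y}` are locally classes of differential operators. -/
theorem Transfer.exists_res_eq_mk {U V : Opens Z} (hV : V ≤ U) (s : Transfer hp U) {z : Z}
    (hz : z ∈ V) : ∃ (N : Opens Z) (hN : N ≤ V) (P : DiffOp E N), z ∈ N ∧
      Transfer.res hp (hN.trans hV) s = Transfer.mk hp P := by
  obtain ⟨W, hW, P, hzW, h⟩ := s.2 z (hV hz)
  have h1 : W ⊓ V ≤ W := inf_le_left
  have h2 : W ⊓ V ≤ V := inf_le_right
  refine ⟨W ⊓ V, h2, DiffOp.res h1 P, ⟨hzW, hz⟩, Subtype.ext (funext fun w => ?_)⟩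
  exact (h w.1 (h1 w.2)).trans (cls_res hp h1 P w.1 w.2).symm

variable [FiniteDimensional ℂ E] [FiniteDimensional ℂ F]

/-- Operators that vanish in `D_{Z→Y}` annihilate pull-backs of smooth functions. -/
theorem app_pullback_eq_zero_of_mk_eq_zero {U : Opens Z} {P : DiffOp E U}
    (h : Transfer.mk hp P = 0) {V : Opens Z} (hV : V ≤ U) (f : Smooth F (img hp V)) :
    P.app V hV (pullback hp V f) = 0 := by
  refine Smooth.ext_of_res fun z hz => ?_
  have h0 : cls hp P z (hV hz) = 0 := congrFun (congrArg Subtype.val h) ⟨z, hV hz⟩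
  obtain ⟨W, hW, hzW, h1⟩ := exists_app_pullback_eq_zero h0
  have h2 : V ⊓ W ≤ V := inf_le_left
  have h3 : V ⊓ W ≤ W := inf_le_right
  refine ⟨V ⊓ W, h2, ⟨hz, hzW⟩, ?_⟩
  rw [DiffOp.smoothRes_app, res_pullback, h1 _ h3, map_zero]

theorem app_pullback_congr {U : Opens Z} {P Q : DiffOp E U}
    (h : Transfer.mk hp P = Transfer.mk hp Q) {V : Opens Z} (hV : V ≤ U)
    (f : Smooth F (img hp V)) :
    P.app V hV (pullback hp V f) = Q.app V hV (pullback hp V f) := by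
  have h0 : Transfer.mk hp (P - Q) = 0 := by
    rw [← sub_add_cancel P Q, Transfer.mk_add] at h
    exact add_eq_right.1 h
  have := app_pullback_eq_zero_of_mk_eq_zero h0 hV f
  rwa [DiffOp.sub_app, sub_eq_zero] at this

/-- The action of a section of `D_{Z→Y}` on a smooth function on the base: there is a smooth
function that is locally `P (f ∘ p)` for all local representatives `P` of the section. -/
theorem Transfer.exists_act {U : Opens Z} (s : Transfer hp U) {V : Opens Z} (hV : V ≤ U)
    (f : Smooth F (img hp V)) : ∃ g : Smooth E V, ∀ (N : Opens Z) (hN : N ≤ V) (P : DiffOp E N),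
      Transfer.res hp (hN.trans hV) s = Transfer.mk hp P →
      Smooth.res hN g = P.app N le_rfl (pullback hp N (Smooth.res (img_mono hp hN) f)) := by
  choose N hN P hz hP using fun z : V => s.exists_res_eq_mk hV z.2
  let val : ∀ z : V, Smooth E (N z) := fun z =>
    (P z).app (N z) le_rfl (pullback hp (N z) (Smooth.res (img_mono hp (hN z)) f))
  -- The value at `z` does not depend on the representative. This gives smoothness of the glued
  -- function and its formula for every representative.
  have key : ∀ (z : V) (M : Opens Z) (hM : M ≤ V) (Q : DiffOp E M) (hzM : z.1 ∈ M),
      Transfer.res hp (hM.trans hV) s = Transfer.mk hp Q → (val z).1 ⟨z.1, hz z⟩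
        = (Q.app M le_rfl (pullback hp M (Smooth.res (img_mono hp hM) f))).1 ⟨z.1, hzM⟩ := by
    intro z M hM Q hzM hQ
    have h1 : N z ⊓ M ≤ N z := inf_le_left
    have h2 : N z ⊓ M ≤ M := inf_le_right
    have e : Transfer.mk hp (DiffOp.res h1 (P z)) = Transfer.mk hp (DiffOp.res h2 Q) := by
      rw [← Transfer.res_mk, ← Transfer.res_mk, ← hP, ← hQ]; rfl
    have e1 : Smooth.res h1 (val z) = Smooth.res h2
        (Q.app M le_rfl (pullback hp M (Smooth.res (img_mono hp hM) f))) := by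
      rw [DiffOp.smoothRes_app, DiffOp.smoothRes_app]
      exact app_pullback_congr e le_rfl (Smooth.res (img_mono hp (h1.trans (hN z))) f)
    exact congrArg (fun g : Smooth E (N z ⊓ M) => g.1 ⟨z.1, hz z, hzM⟩) e1
  refine ⟨⟨fun z => (val z).1 ⟨z.1, hz z⟩, fun z => ?_⟩, fun M hM Q hQ => ?_⟩
  · have h1 := (contMDiffAt_subtype_iff (x := z)).2 (contMDiffAt_extend (val z) ⟨z.1, hz z⟩)
    refine h1.congr_of_eventuallyEq ?_
    have h2 : ∀ᶠ w : V in nhds z, w.1 ∈ N z :=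
      continuous_subtype_val.continuousAt ((N z).2.mem_nhds (hz z))
    filter_upwards [h2] with w hw
    rw [key w (N z) (hN z) (P z) hw (hP z)]
    exact (extend_apply (val z).1 ⟨w.1, hw⟩).symm
  · ext w
    exact key ⟨w.1, hM w.2⟩ M hM Q w.2 hQ

/-- The function `s · f` for a section `s` of `D_{Z→Y}` and a smooth function `f` on the base. -/
def Transfer.act {U : Opens Z} (s : Transfer hp U) {V : Opens Z} (hV : V ≤ U)
    (f : Smooth F (img hp V)) : Smooth E V := (s.exists_act hV f).choose

theorem Transfer.res_act {U : Opens Z} {s : Transfer hp U} {V : Opens Z} (hV : V ≤ U)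
    (f : Smooth F (img hp V)) {N : Opens Z} (hN : N ≤ V) {P : DiffOp E N}
    (h : Transfer.res hp (hN.trans hV) s = Transfer.mk hp P) :
    Smooth.res hN (s.act hV f)
      = P.app N le_rfl (pullback hp N (Smooth.res (img_mono hp hN) f)) :=
  (s.exists_act hV f).choose_spec N hN P h

theorem Transfer.act_eq {U : Opens Z} {s : Transfer hp U} {V : Opens Z} (hV : V ≤ U)
    (f : Smooth F (img hp V)) {P : DiffOp E V} (h : Transfer.res hp hV s = Transfer.mk hp P) :
    s.act hV f = P.app V le_rfl (pullback hp V f) :=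
  Transfer.res_act hV f le_rfl h

theorem Transfer.smoothRes_act {U : Opens Z} (s : Transfer hp U) {V W : Opens Z} (hV : V ≤ U)
    (h : W ≤ V) (f : Smooth F (img hp V)) :
    Smooth.res h (s.act hV f) = s.act (h.trans hV) (Smooth.res (img_mono hp h) f) := by
  refine Smooth.ext_of_res fun z hz => ?_
  obtain ⟨N, hN, P, hzN, hP⟩ := s.exists_res_eq_mk (h.trans hV) hz
  exact ⟨N, hN, hzN, (Transfer.res_act hV f (hN.trans h) hP).trans
    (Transfer.res_act (h.trans hV) (Smooth.res (img_mono hp h) f) hN hP).symm⟩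

/-- A section of `D_{Z→Y}` as a homomorphism `p⁻¹ C^∞_Y → C^∞_Z`. -/
def Transfer.actHom {U : Opens Z} (s : Transfer hp U) : PullbackHom hp U :=
  ⟨fun V =>
    { toFun := fun f => s.act V.2 f
      map_add' := fun f g => by
        refine Smooth.ext_of_res fun z hz => ?_
        obtain ⟨N, hN, P, hzN, hP⟩ := s.exists_res_eq_mk V.2 hz
        refine ⟨N, hN, hzN, ?_⟩
        rw [map_add, Transfer.res_act V.2 _ hN hP, Transfer.res_act V.2 _ hN hP,
          Transfer.res_act V.2 _ hN hP, map_add, map_add, map_add]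
      map_smul' := fun k f => by
        refine Smooth.ext_of_res fun z hz => ?_
        obtain ⟨N, hN, P, hzN, hP⟩ := s.exists_res_eq_mk V.2 hz
        refine ⟨N, hN, hzN, ?_⟩
        rw [map_smul, Transfer.res_act V.2 _ hN hP, Transfer.res_act V.2 _ hN hP, map_smul,
          map_smul, map_smul, RingHom.id_apply] },
    fun V _ h f => s.smoothRes_act V.2 h f⟩

/-- A local representative of `s` annihilates in particular the pull-backs of holomorphic functions,
so its class is zero. -/
theorem Transfer.actHom_injective {U : Opens Z} {s : Transfer hp U} (h : s.actHom = 0) :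
    s = 0 := by
  refine Subtype.ext (funext fun z => ?_)
  obtain ⟨N, hN, P, hzN, hP⟩ := s.exists_res_eq_mk le_rfl z.2
  have e : s.1 z = cls hp P z.1 hzN := congrFun (congrArg Subtype.val hP) ⟨z.1, hzN⟩
  rw [e]
  refine cls_eq_zero_of_app_pullback P hzN fun W hW g _ => ?_
  have e1 : Transfer.res hp (hW.trans hN) s = Transfer.mk hp (DiffOp.res hW P) := by
    rw [← Transfer.res_mk, ← hP]; rfl
  have e2 : s.act (hW.trans hN) g = 0 :=
    congrArg (fun φ : PullbackHom hp U => φ.1 ⟨W, hW.trans hN⟩ g) h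
  rw [← e2, Transfer.act_eq _ _ e1]
  rfl

theorem Transfer.actHom_add {U : Opens Z} (s t : Transfer hp U) :
    (s + t).actHom = s.actHom + t.actHom := by
  refine PullbackHom.ext fun V hV f => Smooth.ext_of_res fun z hz => ?_
  obtain ⟨M, hM, P, hzM, hP⟩ := s.exists_res_eq_mk hV hz
  obtain ⟨N, hN, Q, hzN, hQ⟩ := t.exists_res_eq_mk (hM.trans hV) hzM
  have hP' : Transfer.res hp ((hN.trans hM).trans hV) s = Transfer.mk hp (DiffOp.res hN P) := by
    rw [← Transfer.res_mk, ← hP]; rfl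
  have hPQ : Transfer.res hp ((hN.trans hM).trans hV) (s + t)
      = Transfer.mk hp (DiffOp.res hN P + Q) := by
    rw [Transfer.res_add, Transfer.mk_add, hP', hQ]
  refine ⟨N, hN.trans hM, hzN, (Transfer.res_act hV f _ hPQ).trans ?_⟩
  have : Smooth.res (hN.trans hM) (s.act hV f + t.act hV f) = _ + _ := map_add _ _ _
  refine Eq.trans ?_ this.symm
  rw [Transfer.res_act hV f _ hP', Transfer.res_act hV f _ hQ]
  rfl

theorem Transfer.actHom_smul {U : Opens Z} (R : DiffOp E U) (s : Transfer hp U) :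
    (R • s).actHom = R • s.actHom := by
  refine PullbackHom.ext fun V hV f => Smooth.ext_of_res fun z hz => ?_
  obtain ⟨N, hN, P, hzN, hP⟩ := s.exists_res_eq_mk hV hz
  have hRP : Transfer.res hp (hN.trans hV) (R • s)
      = Transfer.mk hp (DiffOp.res (hN.trans hV) R * P) := by
    rw [Transfer.res_smul, Transfer.mk_mul, hP]
  refine ⟨N, hN, hzN, (Transfer.res_act hV f hN hRP).trans ?_⟩
  have : Smooth.res hN (R.app V hV (s.act hV f)) = _ := R.smoothRes_app hV hN _
  refine Eq.trans ?_ this.symm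
  rw [Transfer.res_act hV f hN hP]
  rfl

/-- Locally both sides are `P ((Q f) ∘ p)`, because the lift `R` acts as `Q` on smooth pull-backs.
-/
theorem Transfer.actHom_rightMul {U : Opens Z} {s t : Transfer hp U} {Q : DiffOp F (img hp U)}
    (h : IsRightMul hp s Q t) : t.actHom = PullbackHom.rightMul hp s.actHom Q := by
  refine PullbackHom.ext fun V hV f => Smooth.ext_of_res fun z hz => ?_
  obtain ⟨W, hW, P, R, hzW, hR, hs, ht⟩ := h z (hV hz)
  have hNV : V ⊓ W ≤ V := inf_le_left
  have hNW : V ⊓ W ≤ W := inf_le_right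
  have hs' : Transfer.res hp (hNV.trans hV) s = Transfer.mk hp (DiffOp.res hNW P) := by
    rw [← Transfer.res_mk, ← hs]; rfl
  have ht' : Transfer.res hp (hNV.trans hV) t = Transfer.mk hp (DiffOp.res hNW (P * R)) := by
    rw [← Transfer.res_mk, ← ht]; rfl
  refine ⟨V ⊓ W, hNV, ⟨hz, hzW⟩, (Transfer.res_act hV f hNV ht').trans ?_⟩
  refine Eq.trans ?_
    (Transfer.res_act hV (Q.app (img hp V) (img_mono hp hV) f) hNV hs').symm
  rw [DiffOp.res_app, DiffOp.res_app, DiffOp.mul_app, hR.app_pullback, DiffOp.smoothRes_app]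
  rfl

theorem Transfer.actHom_mk {U : Opens Z} (P : DiffOp E U) {V : Opens Z} (hV : V ≤ U)
    (f : Smooth F (img hp V)) :
    (Transfer.mk hp P).actHom.1 ⟨V, hV⟩ f = P.app V hV (pullback hp V f) :=
  Transfer.act_eq hV f (Transfer.res_mk hV P)

variable (hp) in
/-- The homomorphism `D_{Z→Y} → Hom(p⁻¹ C^∞_Y, C^∞_Z)`. -/
def transferHom : BimoduleHom hp where
  app _ :=
    { toFun := Transfer.actHom
      map_add' := Transfer.actHom_add
      map_smul' := Transfer.actHom_smul }
  -- The property by which the value of `act` is chosen mentions `s` only through its restrictions,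
  -- and these agree definitionally.
  naturality _ _ _ _ := rfl
  map_rightMul _ _ _ _ := Transfer.actHom_rightMul

theorem transferHom_unit : (transferHom hp).app ⊤ (Transfer.unit hp) = smoothPullback hp :=
  PullbackHom.ext fun _ hV f => Transfer.actHom_mk 1 hV f

theorem transferHom_injective (U : Opens Z) : Function.Injective ((transferHom hp).app U) :=
  (injective_iff_map_eq_zero _).2 fun _ => Transfer.actHom_injective

/-- Every section is locally `P · 1`, so naturality and left linearity determine the homomorphism
from the image of the unit. -/
theorem BimoduleHom.eq_transferHom (Ψ : BimoduleHom hp)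
    (h : Ψ.app ⊤ (Transfer.unit hp) = smoothPullback hp) : Ψ = transferHom hp := by
  refine BimoduleHom.ext (funext fun U => LinearMap.ext fun s => PullbackHom.ext fun V hV f =>
    Smooth.ext_of_res fun z hz => ?_)
  obtain ⟨N, hN, P, hzN, hP⟩ := s.exists_res_eq_mk hV hz
  refine ⟨N, hN, hzN, Eq.trans ?_ (Transfer.res_act hV f hN hP).symm⟩
  have e : Ψ.app N (Transfer.res hp (hN.trans hV) s)
      = P • PullbackHom.res hp le_top (smoothPullback hp) := by
    rw [hP, ← h, ← Ψ.naturality, ← map_smul, Transfer.unit, Transfer.res_mk, ← Transfer.mk_mul,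
      map_one, mul_one]
  have e1 := congrArg (fun φ : PullbackHom hp N => φ.1 ⟨N, Set.mem_Iic.2 le_rfl⟩
    (Smooth.res (img_mono hp hN) f)) e
  rw [Ψ.naturality] at e1
  exact ((Ψ.app U s).2 ⟨V, hV⟩ ⟨N, hN.trans hV⟩ hN f).trans e1

/-- The local classes of `P R` glue: on overlaps two such products send `g ∘ p` to the same
function, so they differ by an operator of zero class. -/
theorem exists_isRightMul {U : Opens Z} (s : Transfer hp U) (Q : DiffOp F (img hp U)) :
    ∃ t : Transfer hp U, IsRightMul hp s Q t := by
  have loc : ∀ z : U, ∃ (V : Opens Z) (hV : V ≤ U) (P R : DiffOp E V), z.1 ∈ V ∧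
      Transfer.res hp hV s = Transfer.mk hp P ∧
      ∀ (W : Opens Z) (hW : W ≤ V) (f : Smooth F (img hp W)), R.app W hW (pullback hp W f)
        = pullback hp W (Q.app (img hp W) (img_mono hp (hW.trans hV)) f) := by
    intro z
    obtain ⟨M, hM, R, hzM, hR⟩ := exists_lift Q z.2
    obtain ⟨N, hN, P, hzN, hP⟩ := s.exists_res_eq_mk hM hzM
    exact ⟨N, hN.trans hM, P, DiffOp.res hN R, hzN, hP, fun W hW f => hR W (hW.trans hN) f⟩
  choose V hV P R hz hP hR using loc
  have key : ∀ (z w : U) (hw : w.1 ∈ V z),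
      cls hp (P w * R w) w.1 (hz w) = cls hp (P z * R z) w.1 hw := by
    intro z w hw
    have h1 : V w ⊓ V z ≤ V w := inf_le_left
    have h2 : V w ⊓ V z ≤ V z := inf_le_right
    have hwN : w.1 ∈ V w ⊓ V z := ⟨hz w, hw⟩
    have e : Transfer.mk hp (DiffOp.res h1 (P w)) = Transfer.mk hp (DiffOp.res h2 (P z)) := by
      rw [← Transfer.res_mk, ← Transfer.res_mk, ← hP, ← hP]; rfl
    have h0 : cls hp (DiffOp.res h1 (P w * R w) - DiffOp.res h2 (P z * R z)) w.1 hwN = 0 := by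
      refine cls_eq_zero_of_app_pullback _ _ fun W hW g _ => ?_
      rw [DiffOp.sub_app, DiffOp.res_app, DiffOp.res_app, DiffOp.mul_app, DiffOp.mul_app, hR, hR,
        sub_eq_zero]
      -- Applied to `Q g` as a smooth function, so its holomorphy need not be known.
      exact app_pullback_congr e hW _
    rw [← cls_res hp h1 _ _ hwN, ← cls_res hp h2 _ _ hwN, ← sub_eq_zero, ← h0, sub_eq_add_neg,
      sub_eq_add_neg, cls_add]
    congr 1
  refine ⟨⟨fun z => cls hp (P z * R z) z.1 (hz z), fun z hzU =>
    ⟨V ⟨z, hzU⟩, hV _, P ⟨z, hzU⟩ * R ⟨z, hzU⟩, hz ⟨z, hzU⟩, fun w hw =>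
      key ⟨z, hzU⟩ ⟨w, hV _ hw⟩ hw⟩⟩, fun z hzU => ?_⟩
  exact ⟨V ⟨z, hzU⟩, hV _, P ⟨z, hzU⟩, R ⟨z, hzU⟩, hz ⟨z, hzU⟩,
    isLift_of_app_pullback (hR ⟨z, hzU⟩), hP _,
    Subtype.ext (funext fun w => key ⟨z, hzU⟩ ⟨w.1, hV _ w.2⟩ w.2)⟩

end Action

end HolD

end

/-! ### The theorem. -/

theorem proposition3p2
    {E : Type*} [NormedAddCommGroup E] [NormedSpace ℂ E] [FiniteDimensional ℂ E]
    {F : Type*} [NormedAddCommGroup F] [NormedSpace ℂ F] [FiniteDimensional ℂ F]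
    {Z : Type*} [TopologicalSpace Z] [ChartedSpace E Z] [IsManifold 𝓘(ℂ, E) ω Z]
    {Y : Type*} [TopologicalSpace Y] [ChartedSpace F Y] [IsManifold 𝓘(ℂ, F) ω Y]
    (p : Z → Y) (hp : IsSubmersion 𝓘(ℂ, E) 𝓘(ℂ, F) ω p) :
    (∀ (U : Opens Z) (s : HolD.Transfer hp U) (Q : HolD.DiffOp F (HolD.img hp U)),
      ∃! t : HolD.Transfer hp U, HolD.IsRightMul hp s Q t) ∧
    (∃ Φ : HolD.BimoduleHom hp,
      Φ.app ⊤ (HolD.Transfer.unit hp) = HolD.smoothPullback hp ∧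
      (∀ U : Opens Z, Function.Injective (Φ.app U)) ∧
      ∀ Ψ : HolD.BimoduleHom hp,
        Ψ.app ⊤ (HolD.Transfer.unit hp) = HolD.smoothPullback hp → Ψ = Φ) ∧
    (∀ P : HolD.DiffOp E (⊤ : Opens Z), P • HolD.Transfer.unit hp = 0 →
      P • HolD.smoothPullback hp = 0 ∧
      (HolD.DiffOp.toEnd ⊤ P).conj • HolD.smoothPullback hp = 0) := by
  refine ⟨fun U s Q => ?_, ⟨HolD.transferHom hp, HolD.transferHom_unit,
    HolD.transferHom_injective, fun Ψ hΨ => Ψ.eq_transferHom hΨ⟩, fun P hP => ?_⟩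
  · obtain ⟨t, ht⟩ := HolD.exists_isRightMul s Q
    -- Two candidates for `s · Q` have the same image, namely that of `s` composed with `Q`.
    refine ⟨t, ht, fun t' ht' => HolD.transferHom_injective U ?_⟩
    rw [(HolD.transferHom hp).map_rightMul U s t Q ht,
      (HolD.transferHom hp).map_rightMul U s t' Q ht']
  · have h0 : P • HolD.smoothPullback hp = 0 := by
      rw [← HolD.transferHom_unit, ← map_smul, hP, map_zero]
    refine ⟨h0, HolD.PullbackHom.ext fun V hV f => ?_⟩
    -- Conjugation commutes with pull-back, so the conjugate operator on `f ∘ p` is the conjugate of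
    -- `P` on the pull-back of `f.conj`.
    have h1 : P.app V hV (HolD.pullback hp V f.conj) = 0 :=
      congrArg (fun φ : HolD.PullbackHom hp ⊤ => φ.1 ⟨V, hV⟩ f.conj) h0
    refine (congrArg HolD.Smooth.conj h1).trans ?_
    ext z
    exact map_zero (starRingEnd ℂ)
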